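/- **Setting.** Let $\mathcal T$ be a finite rooted binary tree in which every internal node has a left and a right child, with set of internal nodes $\mathcal N$ and set of leaves $\mathcal L$. Let $\sigma(p)=s(\alpha p)$ with a scaling factor $0<\alpha<\infty$, where $s:\mathbb R\to[0,1]$ is differentiable with Lipschitz derivative and satisfies $s(-p)=1-s(p)$ for all $p$, $\lim_{p\to\infty}s(p)=1$ and $\lim_{p\to-\infty}s(p)=0$ (for example $s(p)=\tfrac12\operatorname{erf}(p)+\tfrac12$). The ensemble of $M$ soft trees of architecture $\mathcal T$ on $\mathbb R^F$ has parameters $\theta=(w_{m,n},\pi_{m,\ell})$ with $w_{m,n}\in\mathbb R^F$, $\pi_{m,\ell}\in\mathbb R$ ($1\le m\le M$, $n\in\mathcal N$, $\ell\in\mathcal L$) and output $$f(x,\theta)=\frac1{\sqrt M}\sum_{m=1}^M\sum_{\ell\in\mathcal L}\pi_{m,\ell}\prod_{n:\ \ell\text{ in the left subtree of }n}\sigma(w_{m,n}^\top x)\prod_{n:\ \ell\text{ in the right subtree of }n}\bigl(1-\sigma(w_{m,n}^\top x)\bigr).$$ Its neural tangent kernel at $\theta$ is $\widehat\Theta_\theta(x,x')=\langle\nabla_\theta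 f(x,\theta),\nabla_\theta f(x',\theta)\rangle$. At initialization all coordinates of $\theta_0$ are independent standard Gaussians (the NTK initialization). **Theorem.** Let $N\ge1$, let $x_1,\dots,x_N\in\mathbb R^F$ be pairwise distinct with $\|x_i\|_2=1$ for all $i$, and let $y_1,\dots,y_N\in\mathbb R$ be targets. Then $\widehat\Theta_{\theta_0}(x_i,x_j)$ converges in probability, as $M\to\infty$, to a deterministic limit $H_{ij}$ for all $i,j$ (the limiting NTK). Let $\lambda_{\min}$ and $\lambda_{\max}$ be the minimum and maximum eigenvalues of the matrix $H=(H_{ij})$, and let $0<\eta<2/(\lambda_{\min}+\lambda_{\max})$. Then for every $\delta>0$ there are constants $C$ and $M_0$ such that for every $M\ge M_0$, with probability at least $1-\delta$ over $\theta_0$, the gradient flow $$\frac{d\theta_\tau}{d\tau}=-\eta\,\nabla_\theta L(\theta_\tau),\qquad L(\theta)=\frac12\sum_{i=1}^N\bigl(f(x_i,\theta)-y_i\bigr)^2,$$ started at $\theta_0$ has a solution on $[0,\infty)$, and every such solution satisfies $$\sup_{\tau\ge0}\ \max_{1\le i,j\le N}\ \bigl|\widehat\Theta_{\theta_\tau}(x_i,x_j)-\widehat\Theta_{\theta_0}(x_i,x_j)\bigr|\le\frac{C}{\sqrt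 M}.$$ -/

import Mathlib

open MeasureTheory ProbabilityTheory Filter Topology
open scoped NNReal

noncomputable section

namespace SoftTree

/-! ### Tree architectures

An architecture is a finite rooted binary tree `t : BinaryTree Unit`, whose internal nodes are the
`node`s (each with a left and a right child) and whose leaves are the `nil`s. -/

/-- The internal nodes of a tree: the root, or an internal node of the left or right subtree. -/
def Node : BinaryTree Unit → Type
  | .nil => Empty
  | .node _ l r => Option (Node l ⊕ Node r)

/-- The leaves of a tree. -/
def Leaf : BinaryTree Unit → Type
  | .nil => Unit
  | .node _ l r => Leaf l ⊕ Leaf r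

instance instFintypeNode : (t : BinaryTree Unit) → Fintype (Node t)
  | .nil => inferInstanceAs (Fintype Empty)
  | .node _ l r =>
    letI := instFintypeNode l
    letI := instFintypeNode r
    inferInstanceAs (Fintype (Option (Node l ⊕ Node r)))

instance instFintypeLeaf : (t : BinaryTree Unit) → Fintype (Leaf t)
  | .nil => inferInstanceAs (Fintype Unit)
  | .node _ l r =>
    letI := instFintypeLeaf l
    letI := instFintypeLeaf r
    inferInstanceAs (Fintype (Leaf l ⊕ Leaf r))

instance instDecidableEqNode : (t : BinaryTree Unit) → DecidableEq (Node t)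
  | .nil => inferInstanceAs (DecidableEq Empty)
  | .node _ l r =>
    letI := instDecidableEqNode l
    letI := instDecidableEqNode r
    inferInstanceAs (DecidableEq (Option (Node l ⊕ Node r)))

instance instDecidableEqLeaf : (t : BinaryTree Unit) → DecidableEq (Leaf t)
  | .nil => inferInstanceAs (DecidableEq Unit)
  | .node _ l r =>
    letI := instDecidableEqLeaf l
    letI := instDecidableEqLeaf r
    inferInstanceAs (DecidableEq (Leaf l ⊕ Leaf r))

/-- `inLeft t ℓ n` is true iff the leaf `ℓ` belongs to the left subtree of the node `n`. -/
def inLeft : (t : BinaryTree Unit) → Leaf t → Node t → Bool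
  | .nil, _, n => Empty.elim n
  | .node _ _ _, .inl _, none => true
  | .node _ _ _, .inr _, none => false
  | .node _ l _, .inl ℓ, some (.inl n) => inLeft l ℓ n
  | .node _ _ r, .inr ℓ, some (.inr n) => inLeft r ℓ n
  | .node _ _ _, .inl _, some (.inr _) => false
  | .node _ _ _, .inr _, some (.inl _) => false

/-- `inRight t ℓ n` is true iff the leaf `ℓ` belongs to the right subtree of the node `n`. -/
def inRight : (t : BinaryTree Unit) → Leaf t → Node t → Bool
  | .nil, _, n => Empty.elim n
  | .node _ _ _, .inl _, none => false
  | .node _ _ _, .inr _, none => true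
  | .node _ l _, .inl ℓ, some (.inl n) => inRight l ℓ n
  | .node _ _ r, .inr ℓ, some (.inr n) => inRight r ℓ n
  | .node _ _ _, .inl _, some (.inr _) => false
  | .node _ _ _, .inr _, some (.inl _) => false

/-! ### Decision functions -/

/-- A smooth sigmoid-like function: with values in `[0, 1]`, rotationally symmetric about the point
`(0, 1/2)`, with limits `0` and `1` at `-∞` and `+∞`, and differentiable with Lipschitz derivative
(so that the gradient flow of the model is well defined). -/
structure IsSigmoidLike (s : ℝ → ℝ) : Prop where
  mem_Icc : ∀ p, s p ∈ Set.Icc (0 : ℝ) 1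
  symm : ∀ p, s (-p) = 1 - s p
  tendsto_atTop : Tendsto s atTop (𝓝 1)
  tendsto_atBot : Tendsto s atBot (𝓝 0)
  differentiable : Differentiable ℝ s
  lipschitz_deriv : ∃ K : ℝ≥0, LipschitzWith K (deriv s)

/-- The decision function with scaling factor `α`. -/
def decision (s : ℝ → ℝ) (α : ℝ) (p : ℝ) : ℝ := s (α * p)

/-! ### The model -/

/-- The space of all trainable parameters `(w, π)` of an ensemble of `M` trees with architecture
`t` on inputs with `F` features: the coordinate `(m, Sum.inl (n, k))` is the `k`-th entry of the
splitting vector of the internal node `n` of tree `m`, and the coordinate `(m, Sum.inr ℓ)` is the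
response of the leaf `ℓ` of tree `m`. -/
abbrev Params (t : BinaryTree Unit) (F M : ℕ) : Type :=
  EuclideanSpace ℝ (Fin M × (Node t × Fin F ⊕ Leaf t))

variable {t : BinaryTree Unit} {F M N : ℕ}

/-- The inner product of the splitting vector of node `n` of tree `m` with the input `x`. -/
def preact (θ : Params t F M) (m : Fin M) (n : Node t) (x : EuclideanSpace ℝ (Fin F)) : ℝ :=
  ∑ k, θ (m, Sum.inl (n, k)) * x k

/-- The probability that the input `x` reaches the leaf `ℓ` of tree `m`. -/
def reach (σ : ℝ → ℝ) (θ : Params t F M) (m : Fin M) (ℓ : Leaf t)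
    (x : EuclideanSpace ℝ (Fin F)) : ℝ :=
  ∏ n : Node t, (if inLeft t ℓ n then σ (preact θ m n x) else 1) *
    (if inRight t ℓ n then 1 - σ (preact θ m n x) else 1)

/-- The prediction of tree `m`. -/
def treeOutput (σ : ℝ → ℝ) (θ : Params t F M) (m : Fin M) (x : EuclideanSpace ℝ (Fin F)) : ℝ :=
  ∑ ℓ : Leaf t, θ (m, Sum.inr ℓ) * reach σ θ m ℓ x

/-- The prediction of the ensemble, with the `1 / √M` scaling. -/
def ensemble (σ : ℝ → ℝ) (θ : Params t F M) (x : EuclideanSpace ℝ (Fin F)) : ℝ :=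
  (1 / Real.sqrt M) * ∑ m : Fin M, treeOutput σ θ m x

/-! ### Neural tangent kernel, initialization and training -/

/-- The neural tangent kernel of the ensemble at the parameter `θ`. -/
def ntk (σ : ℝ → ℝ) (θ : Params t F M) (x x' : EuclideanSpace ℝ (Fin F)) : ℝ :=
  inner ℝ (gradient (fun ϑ : Params t F M => ensemble σ ϑ x) θ)
    (gradient (fun ϑ : Params t F M => ensemble σ ϑ x') θ)

/-- The law of the initial parameter: all coordinates are independent standard Gaussians. -/
def initLaw (t : BinaryTree Unit) (F M : ℕ) : Measure (Params t F M) := stdGaussian (Params t F M)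

/-- `H` is the matrix, on the inputs `x`, of the limiting kernel: the limit in probability of the
neural tangent kernel at initialization as the number of trees tends to infinity. -/
def IsLimitingNTK (t : BinaryTree Unit) (σ : ℝ → ℝ) (x : Fin N → EuclideanSpace ℝ (Fin F))
    (H : Matrix (Fin N) (Fin N) ℝ) : Prop :=
  ∀ i j, ∀ ε : ℝ, 0 < ε →
    Tendsto (fun M : ℕ => initLaw t F M {θ | ε ≤ |ntk σ θ (x i) (x j) - H i j|}) atTop (𝓝 0)

/-- The squared loss on the training set `(x, y)`. -/
def loss (σ : ℝ → ℝ) (x : Fin N → EuclideanSpace ℝ (Fin F)) (y : Fin N → ℝ)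
    (θ : Params t F M) : ℝ :=
  (1 / 2) * ∑ i, (ensemble σ θ (x i) - y i) ^ 2

/-- `θ` is (on `[0, ∞)`) a trajectory of the gradient flow `θ' = -η ∇L(θ)` of the squared loss,
started at `θ₀`. -/
def IsGradientFlow (σ : ℝ → ℝ) (x : Fin N → EuclideanSpace ℝ (Fin F)) (y : Fin N → ℝ) (η : ℝ)
    (θ₀ : Params t F M) (θ : ℝ → Params t F M) : Prop :=
  θ 0 = θ₀ ∧ ∀ τ : ℝ, 0 ≤ τ →
    HasDerivWithinAt θ (-η • gradient (loss σ x y) (θ τ)) (Set.Ici 0) τ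

end SoftTree

end

/-! The ensemble is `1 / √M` times a sum of `M` copies of one function `g i` (a single tree
evaluated at `x i`), each in its own block of parameters, and the blocks are independent under the
Gaussian law. The tangent kernel is therefore an empirical mean of `⟨∇g i, ∇g j⟩` over the trees,
and Chebyshev's inequality gives the limit `H i j = E⟨∇g i, ∇g j⟩`.

The rest is lazy training. In a ball of radius `R` around `θ₀` the displacements `d m` of the trees
satisfy `∑ d m ^ 2 ≤ R ^ 2`, so by Cauchy–Schwarz the mean kernel changes by only `O(1 / √M)`
(`abs_averageKernel_sub_le`). It remains to trap the flow in a ball whose radius is independent of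
`M`. If `2 μ ℓ ≤ ‖∇ℓ‖² ≤ κ² ℓ` there, the loss decays exponentially and the whole path has length at
most `κ √ℓ(θ₀) / μ` (`gradientFlow_mem_closedBall`). The initial loss is bounded in probability
uniformly in `M`, because a tree is odd in its leaf responses and so has mean zero.

The matrix `H` may be singular: for the tree with a single leaf all the `g i` coincide. Let `W` be
the space of `c` with `∑ c i • ∇g i = 0` identically. The component of the residual along `W` is the
same at all parameters and contributes nothing to the gradient, so it is subtracted from the loss.
On `Wᗮ` the matrix `H` is coercive, by the full support of the Gaussian and compactness of the unit
sphere (`exists_pos_limitKernel_coercive`). This supplies the lower inequality for the remaining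
loss (`averageLoss_gradientFlow`). -/

noncomputable section

namespace SoftTree

/-! ### Integral curves on the half-line and trapping of gradient flows. -/

section Flow

variable {E : Type*} [NormedAddCommGroup E]

/-- A bounded Lipschitz vector field has an integral curve on `[0, ∞)` through every point. -/
theorem exists_integralCurve_of_lipschitzWith [NormedSpace ℝ E] [CompleteSpace E] {v : E → E}
    {K L : ℝ≥0} (hK : LipschitzWith K v) (hL : ∀ p, ‖v p‖ ≤ L) (p₀ : E) :
    ∃ γ : ℝ → E, γ 0 = p₀ ∧ ∀ τ, 0 ≤ τ → HasDerivWithinAt γ (v (γ τ)) (Set.Ici 0) τ := by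
  have key : ∀ n : ℕ, ∃ γ : ℝ → E, γ 0 = p₀ ∧
      ∀ τ ∈ Set.Icc (0 : ℝ) n, HasDerivWithinAt γ (v (γ τ)) (Set.Icc (0 : ℝ) n) τ := by
    intro n
    have h0 : (0 : ℝ) ∈ Set.Icc (0 : ℝ) n := ⟨le_rfl, n.cast_nonneg⟩
    -- The field is bounded by `L` everywhere, so the ball of radius `L * n` contains any curve up
    -- to time `n` and no smallness of the interval is needed.
    have hp : IsPicardLindelof (fun _ => v) (⟨0, h0⟩ : Set.Icc (0 : ℝ) n) p₀ (L * n) 0 L K :=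
      IsPicardLindelof.of_time_independent (fun p _ => hL p) hK.lipschitzOnWith (by simp)
    exact hp.exists_eq_forall_mem_Icc_hasDerivWithinAt₀
  choose γ hγ0 hγ using key
  have agree : ∀ m n : ℕ, m ≤ n → ∀ τ ∈ Set.Icc (0 : ℝ) m, γ m τ = γ n τ := by
    intro m n hmn
    have hmn' : (m : ℝ) ≤ n := by exact_mod_cast hmn
    have hd : ∀ k : ℕ, m ≤ k → ∀ τ ∈ Set.Ico (0 : ℝ) m,
        HasDerivWithinAt (γ k) (v (γ k τ)) (Set.Ici τ) τ := by
      intro k hk τ hτ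
      have hk' : (m : ℝ) ≤ k := by exact_mod_cast hk
      refine (hγ k τ ⟨hτ.1, hτ.2.le.trans hk'⟩).mono_of_mem_nhdsWithin ?_
      exact mem_of_superset (Icc_mem_nhdsGE (hτ.2.trans_le hk')) (Set.Icc_subset_Icc_left hτ.1)
    have hc : ∀ k : ℕ, m ≤ k → ContinuousOn (γ k) (Set.Icc (0 : ℝ) m) := by
      intro k hk τ hτ
      have hk' : (m : ℝ) ≤ k := by exact_mod_cast hk
      exact ((hγ k τ ⟨hτ.1, hτ.2.trans hk'⟩).continuousWithinAt).mono (Set.Icc_subset_Icc_right hk')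
    exact ODE_solution_unique (fun _ => hK) (hc m le_rfl) (hd m le_rfl) (hc n hmn) (hd n hmn)
      ((hγ0 m).trans (hγ0 n).symm)
  -- The `+ 1` makes `τ` strictly smaller than the right endpoint of its interval, so a derivative
  -- within `[0, n]` is one within `[0, ∞)`.
  refine ⟨fun τ => γ (⌈τ⌉₊ + 1) τ, hγ0 _, fun τ hτ => ?_⟩
  set n := ⌈τ⌉₊ + 1 with hn
  have hτn : τ < n := by
    have := Nat.le_ceil τ
    rw [hn]; push_cast; linarith
  have hd : HasDerivWithinAt (γ n) (v (γ n τ)) (Set.Ici 0) τ := by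
    refine (hγ n τ ⟨hτ, hτn.le⟩).mono_of_mem_nhdsWithin ?_
    rw [← Set.Ici_inter_Iic]
    exact inter_mem_nhdsWithin _ (Iic_mem_nhds hτn)
  refine hd.congr_of_eventuallyEq ?_ rfl
  have hmem : Set.Ici 0 ∩ Set.Iic (n : ℝ) ∈ 𝓝[Set.Ici 0] τ :=
    inter_mem_nhdsWithin _ (Iic_mem_nhds hτn)
  filter_upwards [hmem] with r hr
  have hr1 : r ≤ ((⌈r⌉₊ + 1 : ℕ) : ℝ) := by
    have := Nat.le_ceil r
    push_cast; linarith
  rcases le_total (⌈r⌉₊ + 1) n with h | h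
  · exact agree _ _ h r ⟨hr.1, hr1⟩
  · exact (agree _ _ h r ⟨hr.1, hr.2⟩).symm

variable [InnerProductSpace ℝ E]

/-- A gradient flow of `ℓ ≥ 0` never leaves a ball of radius `R > κ √ℓ(p₀) / μ` on which
`2 μ ℓ ≤ ‖∇ℓ‖² ≤ κ² ℓ`. -/
theorem gradientFlow_mem_closedBall [CompleteSpace E] {ℓ : E → ℝ} {g v : E → E}
    (hg : ∀ p, HasGradientAt ℓ (g p) p) (hℓ : ∀ p, 0 ≤ ℓ p) {p₀ : E} {η μ κ R : ℝ} (hη : 0 < η)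
    (hμ : 0 < μ) (hκ : 0 ≤ κ) (hR : κ * √(ℓ p₀) / μ < R)
    (hlow : ∀ p ∈ Metric.closedBall p₀ R, 2 * μ * ℓ p ≤ ‖g p‖ ^ 2)
    (hupp : ∀ p ∈ Metric.closedBall p₀ R, ‖g p‖ ^ 2 ≤ κ ^ 2 * ℓ p)
    (hv : ∀ p ∈ Metric.closedBall p₀ R, v p = -η • g p)
    {γ : ℝ → E} (h0 : γ 0 = p₀)
    (hγ : ∀ τ, 0 ≤ τ → HasDerivWithinAt γ (v (γ τ)) (Set.Ici 0) τ) {τ : ℝ} (hτ : 0 ≤ τ) :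
    γ τ ∈ Metric.closedBall p₀ R := by
  -- Let `T` be the first time at distance at least `R`. Before `T` both inequalities hold, so
  -- Grönwall's lemma makes `ℓ` decay at rate `2ημ`. This bounds the path length up to `T` by a
  -- number smaller than `R`.
  by_contra hout
  have hcont : ContinuousOn γ (Set.Ici 0) := fun s hs => (hγ s hs).continuousWithinAt
  have hR0 : 0 < R := lt_of_le_of_lt (by positivity) hR
  set S : Set ℝ := Set.Icc 0 τ ∩ (fun s => ‖γ s - p₀‖) ⁻¹' Set.Ici R with hS
  have hScl : IsCompact S := by
    refine isCompact_Icc.of_isClosed_subset ?_ Set.inter_subset_left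
    exact (((hcont.mono Set.Icc_subset_Ici_self).sub continuousOn_const).norm).preimage_isClosed_of_isClosed
      isClosed_Icc isClosed_Ici
  have hSne : S.Nonempty := by
    refine ⟨τ, ⟨hτ, le_rfl⟩, ?_⟩
    simp only [Metric.mem_closedBall, dist_eq_norm, not_le] at hout
    exact hout.le
  obtain ⟨T, ⟨⟨hT0, hTτ⟩, hTR⟩, hTmin⟩ := hScl.exists_isLeast hSne
  have hin : ∀ s ∈ Set.Ico 0 T, γ s ∈ Metric.closedBall p₀ R := by
    intro s hs
    by_contra hc
    simp only [Metric.mem_closedBall, dist_eq_norm, not_le] at hc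
    exact absurd (hTmin ⟨⟨hs.1, hs.2.le.trans hTτ⟩, hc.le⟩) (not_le.2 hs.2)
  have hder : ∀ s ∈ Set.Ico 0 T, HasDerivWithinAt γ (-η • g (γ s)) (Set.Ici s) s := by
    intro s hs
    rw [← hv _ (hin s hs)]
    exact (hγ s hs.1).mono (Set.Ici_subset_Ici.2 hs.1)
  have hℓder : ∀ s ∈ Set.Ico 0 T,
      HasDerivWithinAt (fun s => ℓ (γ s)) (-η * ‖g (γ s)‖ ^ 2) (Set.Ici s) s := by
    intro s hs
    have h := (hg (γ s)).hasFDerivAt.comp_hasDerivWithinAt s (hder s hs)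
    simpa [Function.comp_def, inner_smul_right, real_inner_self_eq_norm_sq] using h
  have hℓcont : ContinuousOn (fun s => ℓ (γ s)) (Set.Icc 0 T) := by
    have : Continuous ℓ := continuous_iff_continuousAt.2 fun p => (hg p).continuousAt
    exact this.comp_continuousOn (hcont.mono Set.Icc_subset_Ici_self)
  have hdecay : ∀ s ∈ Set.Icc 0 T, ℓ (γ s) ≤ ℓ p₀ * Real.exp (-(2 * η * μ) * s) := by
    intro s hs
    have := le_gronwallBound_of_liminf_deriv_right_le (f := fun s => ℓ (γ s))
      (f' := fun s => -η * ‖g (γ s)‖ ^ 2) (δ := ℓ p₀) (K := -(2 * η * μ)) (ε := 0) hℓcont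
      (fun x hx r hr => (hℓder x hx).liminf_right_slope_le hr) (by simp [h0])
      (fun x hx => by
        have := hlow _ (hin x hx)
        nlinarith) s hs
    simpa [gronwallBound_ε0] using this
  -- The function is the integral of the speed bound `η κ √ℓ(p₀) exp(-ημs)`. It stays below `κ
  -- √ℓ(p₀) / μ`, a bound free of `η`, which only rescales time.
  have hB : ∀ s, HasDerivAt (fun s => κ * √(ℓ p₀) / μ * (1 - Real.exp (-(η * μ) * s)))
      (η * κ * √(ℓ p₀) * Real.exp (-(η * μ) * s)) s := by
    intro s
    have h1 : HasDerivAt (fun s : ℝ => Real.exp (-(η * μ) * s))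
        (Real.exp (-(η * μ) * s) * (-(η * μ) * 1)) s :=
      ((hasDerivAt_id s).const_mul _).exp
    refine ((h1.const_sub 1).const_mul (κ * √(ℓ p₀) / μ)).congr_deriv ?_
    field_simp
  have hfin := image_norm_le_of_norm_deriv_right_le_deriv_boundary
    (f := fun s => γ s - p₀) (f' := fun s => -η • g (γ s)) (a := 0) (b := T)
    ((hcont.mono Set.Icc_subset_Ici_self).sub continuousOn_const)
    (fun s hs => (hder s hs).sub_const p₀) (by simp [h0]) hB
    (fun s hs => by
      have h1 := hupp _ (hin s hs)
      have h2 := hdecay s ⟨hs.1, hs.2.le⟩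
      have h3 : ‖g (γ s)‖ ≤ κ * √(ℓ p₀) * Real.exp (-(η * μ) * s) := by
        refine abs_le_of_sq_le_sq' ?_ (by positivity) |>.2
        have h4 : Real.exp (-(2 * η * μ) * s) = Real.exp (-(η * μ) * s) ^ 2 := by
          rw [← Real.exp_nat_mul]; congr 1; push_cast; ring
        calc ‖g (γ s)‖ ^ 2 ≤ κ ^ 2 * (ℓ p₀ * Real.exp (-(2 * η * μ) * s)) :=
              h1.trans (by gcongr)
          _ = _ := by rw [h4, mul_pow, mul_pow, Real.sq_sqrt (hℓ p₀)]; ring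
      rw [norm_smul, norm_neg, Real.norm_of_nonneg hη.le]
      calc η * ‖g (γ s)‖ ≤ η * (κ * √(ℓ p₀) * Real.exp (-(η * μ) * s)) := by gcongr
        _ = _ := by ring)
    (x := T) ⟨hT0, le_rfl⟩
  have h5 : κ * √(ℓ p₀) / μ * (1 - Real.exp (-(η * μ) * T)) ≤ κ * √(ℓ p₀) / μ := by
    refine mul_le_of_le_one_right (by positivity) ?_
    linarith [Real.exp_pos (-(η * μ) * T)]
  have hTR' : R ≤ ‖γ T - p₀‖ := hTR
  linarith

end Flow

/-! ### Global existence by truncating the gradient field. -/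

section Clamp

variable {ι : Type*} [Fintype ι]

/-- The projection of `EuclideanSpace ℝ ι` onto the cube with centre `c` and half side length
`R`. -/
def clamp (c : EuclideanSpace ℝ ι) (R : ℝ) (p : EuclideanSpace ℝ ι) : EuclideanSpace ℝ ι :=
  WithLp.toLp 2 fun i => max (c i - R) (min (c i + R) (p i))

theorem lipschitzWith_clamp (c : EuclideanSpace ℝ ι) (R : ℝ) : LipschitzWith 1 (clamp c R) := by
  refine LipschitzWith.of_dist_le_mul fun p q => ?_
  rw [NNReal.coe_one, one_mul, EuclideanSpace.dist_eq, EuclideanSpace.dist_eq]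
  refine Real.sqrt_le_sqrt (Finset.sum_le_sum fun i _ => ?_)
  have h : dist (clamp c R p i) (clamp c R q i) ≤ dist (p i) (q i) := by
    have := ((LipschitzWith.id (α := ℝ)).const_min (c i + R)).const_max (c i - R)
    simpa [clamp] using this.dist_le_mul (p i) (q i)
  gcongr

theorem clamp_eq_self {c : EuclideanSpace ℝ ι} {R : ℝ} {p : EuclideanSpace ℝ ι}
    (hp : p ∈ Metric.closedBall c R) : clamp c R p = p := by
  ext i
  have h : |p i - c i| ≤ R := by
    have := PiLp.norm_apply_le (p - c) i
    rw [Metric.mem_closedBall, dist_eq_norm] at hp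
    simpa using this.trans hp
  rw [abs_le] at h
  simp only [clamp]
  rw [min_eq_right (by linarith), max_eq_right (by linarith)]

theorem isBounded_range_clamp (c : EuclideanSpace ℝ ι) (R : ℝ) :
    Bornology.IsBounded (Set.range (clamp c R)) := by
  refine (Metric.isBounded_iff_subset_closedBall c).2 ⟨√(∑ _i : ι, R ^ 2), ?_⟩
  rintro _ ⟨p, rfl⟩
  rw [Metric.mem_closedBall, EuclideanSpace.dist_eq]
  refine Real.sqrt_le_sqrt (Finset.sum_le_sum fun i _ => ?_)
  rw [Real.dist_eq, sq_abs, ← sq_abs R]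
  have h : |clamp c R p i - c i| ≤ |R| := by
    simp only [clamp]
    rcases abs_cases R with ⟨h, _⟩ | ⟨h, _⟩ <;> rw [h, abs_le] <;> constructor <;>
      rcases max_cases (c i - R) (min (c i + R) (p i)) with ⟨h1, _⟩ | ⟨h1, _⟩ <;>
      linarith [min_le_left (c i + R) (p i)]
  rw [← sq_abs (clamp c R p i - c i)]
  gcongr

/-- If `ℓ ≥ 0` has a locally Lipschitz gradient and satisfies `2 μ ℓ ≤ ‖∇ℓ‖² ≤ κ² ℓ` on a ball
around `p₀` of radius `R > κ √ℓ(p₀) / μ`, then the gradient flow started at `p₀` exists for all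
times. -/
theorem exists_gradientFlow {ℓ : EuclideanSpace ℝ ι → ℝ}
    {g : EuclideanSpace ℝ ι → EuclideanSpace ℝ ι}
    (hg : ∀ p, HasGradientAt ℓ (g p) p) (hgl : LocallyLipschitz g) (hℓ : ∀ p, 0 ≤ ℓ p)
    {p₀ : EuclideanSpace ℝ ι} {η μ κ R : ℝ} (hη : 0 < η)
    (hμ : 0 < μ) (hκ : 0 ≤ κ) (hR : κ * √(ℓ p₀) / μ < R)
    (hlow : ∀ p ∈ Metric.closedBall p₀ R, 2 * μ * ℓ p ≤ ‖g p‖ ^ 2)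
    (hupp : ∀ p ∈ Metric.closedBall p₀ R, ‖g p‖ ^ 2 ≤ κ ^ 2 * ℓ p) :
    ∃ γ : ℝ → EuclideanSpace ℝ ι, γ 0 = p₀ ∧
      ∀ τ, 0 ≤ τ → HasDerivWithinAt γ (-η • g (γ τ)) (Set.Ici 0) τ := by
  -- On a compact set containing the cube the locally Lipschitz field is Lipschitz and bounded.
  -- Composing with the 1-Lipschitz `clamp` extends both properties to the whole space.
  have hcpt : IsCompact (closure (Set.range (clamp p₀ R))) :=
    (isBounded_range_clamp p₀ R).isCompact_closure
  obtain ⟨K, hK⟩ := (hgl.locallyLipschitzOn (s := closure (Set.range (clamp p₀ R)))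
    ).exists_lipschitzOnWith_of_compact hcpt
  obtain ⟨B, hB⟩ := hcpt.exists_bound_of_continuousOn hgl.continuous.continuousOn
  have hmem : ∀ p, clamp p₀ R p ∈ closure (Set.range (clamp p₀ R)) :=
    fun p => subset_closure ⟨p, rfl⟩
  have hlip : LipschitzWith (‖-η‖₊ * (K * 1)) fun p => -η • g (clamp p₀ R p) := by
    have h1 : LipschitzWith (K * 1) (g ∘ clamp p₀ R) := by
      rw [← lipschitzOnWith_univ]
      exact hK.comp (lipschitzWith_clamp p₀ R).lipschitzOnWith fun p _ => hmem p
    exact (lipschitzWith_smul (-η)).comp h1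
  obtain ⟨γ, h0, hγ⟩ := exists_integralCurve_of_lipschitzWith hlip
    (L := ‖-η‖₊ * B.toNNReal) (fun p => by
      rw [norm_smul, NNReal.coe_mul, coe_nnnorm]
      gcongr
      exact (hB _ (hmem p)).trans (Real.le_coe_toNNReal B)) p₀
  -- Trapping needs the field only on the ball. The ball lies in the cube, where `clamp` is the
  -- identity, so the truncated flow is the true one.
  have hball := fun τ (hτ : 0 ≤ τ) => gradientFlow_mem_closedBall hg hℓ hη hμ hκ hR hlow hupp
    (v := fun p => -η • g (clamp p₀ R p)) (fun p hp => by simp only [clamp_eq_self hp]) h0 hγ hτ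
  refine ⟨γ, h0, fun τ hτ => ?_⟩
  have := hγ τ hτ
  rwa [clamp_eq_self (hball τ hτ)] at this

end Clamp

/-! ### Classes of functions with Lipschitz or locally Lipschitz derivative. -/

section Calculus

variable {E : Type*} [NormedAddCommGroup E] [NormedSpace ℝ E]

/-- `h` is bounded by `C`, with a derivative that is bounded by `C` and `C`-Lipschitz. -/
structure BoundedC11 (C : ℝ) (h : E → ℝ) : Prop where
  differentiable : Differentiable ℝ h
  abs_le : ∀ p, |h p| ≤ C
  norm_fderiv_le : ∀ p, ‖fderiv ℝ h p‖ ≤ C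
  fderiv_lipschitz : ∀ p q, ‖fderiv ℝ h p - fderiv ℝ h q‖ ≤ C * ‖p - q‖

/-- The derivative of `h` grows at most linearly and is Lipschitz on bounded sets, with a constant
that grows at most linearly. -/
structure LinearGrowthC11 (C : ℝ) (h : E → ℝ) : Prop where
  differentiable : Differentiable ℝ h
  norm_fderiv_le : ∀ p, ‖fderiv ℝ h p‖ ≤ C * (1 + ‖p‖)
  fderiv_lipschitz : ∀ p q, ‖fderiv ℝ h p - fderiv ℝ h q‖ ≤ C * (1 + ‖p‖ + ‖q‖) * ‖p - q‖

theorem norm_smul_sub_smul_le {F : Type*} [NormedAddCommGroup F] [NormedSpace ℝ F] (a b : ℝ)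
    (u v : F) : ‖a • u - b • v‖ ≤ |a| * ‖u - v‖ + |a - b| * ‖v‖ := by
  have : a • u - b • v = a • (u - v) + (a - b) • v := by module
  rw [this]
  refine (norm_add_le _ _).trans ?_
  simp [norm_smul]

namespace BoundedC11

variable {C D : ℝ} {h k : E → ℝ}

theorem nonneg (hh : BoundedC11 C h) : 0 ≤ C := (abs_nonneg _).trans (hh.abs_le 0)

theorem abs_sub_le (hh : BoundedC11 C h) (p q : E) : |h p - h q| ≤ C * ‖p - q‖ := by
  have := Convex.norm_image_sub_le_of_norm_fderiv_le (f := h) (𝕜 := ℝ) (s := Set.univ) (C := C)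
    (fun x _ => hh.differentiable x) (fun x _ => hh.norm_fderiv_le x) convex_univ
    (Set.mem_univ q) (Set.mem_univ p)
  simpa using this

theorem const (c : ℝ) : BoundedC11 |c| (fun _ : E => c) where
  differentiable := differentiable_const c
  abs_le _ := le_rfl
  norm_fderiv_le p := by simp
  fderiv_lipschitz p q := by simp; positivity

theorem one_sub (hh : BoundedC11 C h) : BoundedC11 (1 + C) fun p => 1 - h p where
  differentiable := hh.differentiable.const_sub 1
  abs_le p := (abs_sub 1 (h p)).trans (by rw [abs_one]; linarith [hh.abs_le p])
  norm_fderiv_le p := by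
    rw [fderiv_const_sub, norm_neg]
    linarith [hh.norm_fderiv_le p]
  fderiv_lipschitz p q := by
    rw [fderiv_const_sub, fderiv_const_sub, neg_sub_neg, norm_sub_rev]
    refine (hh.fderiv_lipschitz p q).trans ?_
    gcongr
    linarith

/-- The factor `4` counts the terms in the Lipschitz estimate for the derivative of a product. -/
theorem mul (hh : BoundedC11 C h) (hk : BoundedC11 D k) :
    BoundedC11 (4 * (C * D)) fun p => h p * k p := by
  have hC := hh.nonneg
  have hD := hk.nonneg
  have hd : ∀ p, fderiv ℝ (fun p => h p * k p) p = h p • fderiv ℝ k p + k p • fderiv ℝ h p :=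
    fun p => fderiv_fun_mul (hh.differentiable p) (hk.differentiable p)
  refine ⟨hh.differentiable.mul hk.differentiable, fun p => ?_, fun p => ?_, fun p q => ?_⟩
  · rw [abs_mul]
    have := mul_le_mul (hh.abs_le p) (hk.abs_le p) (abs_nonneg _) hC
    nlinarith [mul_nonneg hC hD]
  · rw [hd]
    refine (norm_add_le _ _).trans ?_
    rw [norm_smul, norm_smul, Real.norm_eq_abs, Real.norm_eq_abs]
    have h1 := mul_le_mul (hh.abs_le p) (hk.norm_fderiv_le p) (norm_nonneg _) hC
    have h2 := mul_le_mul (hk.abs_le p) (hh.norm_fderiv_le p) (norm_nonneg _) hD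
    nlinarith [mul_nonneg hC hD]
  · rw [hd, hd, add_sub_add_comm]
    refine (norm_add_le _ _).trans ?_
    have e1 := norm_smul_sub_smul_le (h p) (h q) (fderiv ℝ k p) (fderiv ℝ k q)
    have e2 := norm_smul_sub_smul_le (k p) (k q) (fderiv ℝ h p) (fderiv ℝ h q)
    have h1 := mul_le_mul (hh.abs_le p) (hk.fderiv_lipschitz p q) (norm_nonneg _) hC
    have h2 := mul_le_mul (hh.abs_sub_le p q) (hk.norm_fderiv_le q) (norm_nonneg _) (by positivity)
    have h3 := mul_le_mul (hk.abs_le p) (hh.fderiv_lipschitz p q) (norm_nonneg _) hD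
    have h4 := mul_le_mul (hk.abs_sub_le p q) (hh.norm_fderiv_le q) (norm_nonneg _) (by positivity)
    linarith

theorem exists_prod {ι : Type*} (s : Finset ι) {h : ι → E → ℝ}
    (hh : ∀ i, ∃ C, BoundedC11 C (h i)) : ∃ C, BoundedC11 C fun p => ∏ i ∈ s, h i p := by
  classical
  induction s using Finset.induction_on with
  | empty => simpa using ⟨_, const 1⟩
  | insert i s hi ih =>
    obtain ⟨C, hC⟩ := hh i
    obtain ⟨D, hD⟩ := ih
    simp only [Finset.prod_insert hi]
    exact ⟨_, hC.mul hD⟩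

theorem exists_comp_clm {s : ℝ → ℝ} (hs : BoundedC11 C s) (L : E →L[ℝ] ℝ) :
    ∃ D, BoundedC11 D fun p => s (L p) := by
  have hC := hs.nonneg
  have hd : ∀ p, fderiv ℝ (fun p => s (L p)) p = (fderiv ℝ s (L p)).comp L := fun p => by
    have := fderiv_comp p (hs.differentiable (L p)) L.differentiableAt
    rwa [L.fderiv] at this
  set n := ‖L‖ with hn
  have hn0 : 0 ≤ n := norm_nonneg L
  refine ⟨C * (1 + n + n ^ 2), hs.differentiable.comp L.differentiable, fun p => ?_, fun p => ?_,
    fun p q => ?_⟩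
  · have := hs.abs_le (L p)
    nlinarith [mul_nonneg hC hn0, mul_nonneg hC (sq_nonneg n)]
  · rw [hd]
    refine (ContinuousLinearMap.opNorm_comp_le _ _).trans ?_
    have := mul_le_mul_of_nonneg_right (hs.norm_fderiv_le (L p)) hn0
    nlinarith [mul_nonneg hC hn0, mul_nonneg hC (sq_nonneg n)]
  · rw [hd, hd, ← ContinuousLinearMap.sub_comp]
    refine (ContinuousLinearMap.opNorm_comp_le _ _).trans ?_
    have h1 := hs.fderiv_lipschitz (L p) (L q)
    have h2 : ‖L p - L q‖ ≤ n * ‖p - q‖ := by rw [← map_sub]; exact L.le_opNorm _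
    calc _ ≤ (C * (n * ‖p - q‖)) * n :=
          mul_le_mul_of_nonneg_right (h1.trans (mul_le_mul_of_nonneg_left h2 hC)) hn0
      _ = C * n ^ 2 * ‖p - q‖ := by ring
      _ ≤ _ := by
        gcongr
        linarith

/-- Models a leaf response times the probability of reaching the leaf. The unbounded linear factor
is what forces linear growth in place of boundedness. -/
theorem exists_clm_mul (hh : BoundedC11 C h) (L : E →L[ℝ] ℝ) :
    ∃ D, LinearGrowthC11 D fun p => L p * h p := by
  have hC := hh.nonneg
  set n := ‖L‖ with hn
  have hn0 : 0 ≤ n := norm_nonneg L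
  have hd : ∀ p, fderiv ℝ (fun p => L p * h p) p = L p • fderiv ℝ h p + h p • L := fun p => by
    have := fderiv_fun_mul (L.differentiableAt (x := p)) (hh.differentiable p)
    rwa [L.fderiv] at this
  have hL : ∀ p, |L p| ≤ n * ‖p‖ := L.le_opNorm
  refine ⟨2 * (C * n), L.differentiable.mul hh.differentiable, fun p => ?_, fun p q => ?_⟩
  · rw [hd]
    refine (norm_add_le _ _).trans ?_
    rw [norm_smul, norm_smul, Real.norm_eq_abs, Real.norm_eq_abs]
    have h1 := mul_le_mul (hL p) (hh.norm_fderiv_le p) (norm_nonneg _) (by positivity)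
    have h2 := mul_le_mul_of_nonneg_right (hh.abs_le p) hn0
    nlinarith [mul_nonneg hC hn0, mul_nonneg (mul_nonneg hC hn0) (norm_nonneg p)]
  · rw [hd, hd, add_sub_add_comm, ← sub_smul]
    refine (norm_add_le _ _).trans ?_
    have e1 := norm_smul_sub_smul_le (L p) (L q) (fderiv ℝ h p) (fderiv ℝ h q)
    have h1 := mul_le_mul (hL p) (hh.fderiv_lipschitz p q) (norm_nonneg _) (by positivity)
    have h2 : |L p - L q| * ‖fderiv ℝ h q‖ ≤ (n * ‖p - q‖) * C :=
      mul_le_mul (by rw [← map_sub]; exact hL _) (hh.norm_fderiv_le q) (norm_nonneg _)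
        (by positivity)
    have h3 := mul_le_mul_of_nonneg_right (hh.abs_sub_le p q) hn0
    rw [norm_smul, Real.norm_eq_abs]
    have h4 : 0 ≤ C * n * ‖p - q‖ := by positivity
    nlinarith [mul_nonneg h4 (norm_nonneg p), mul_nonneg h4 (norm_nonneg q)]

end BoundedC11

namespace LinearGrowthC11

variable {C D : ℝ} {h k : E → ℝ}

theorem mono (hh : LinearGrowthC11 C h) (hCD : C ≤ D) : LinearGrowthC11 D h where
  differentiable := hh.differentiable
  norm_fderiv_le p := (hh.norm_fderiv_le p).trans (by gcongr)
  fderiv_lipschitz p q := (hh.fderiv_lipschitz p q).trans (by gcongr)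

theorem zero : LinearGrowthC11 0 (fun _ : E => 0) where
  differentiable := differentiable_const 0
  norm_fderiv_le p := by simp
  fderiv_lipschitz p q := by simp

theorem add (hh : LinearGrowthC11 C h) (hk : LinearGrowthC11 D k) :
    LinearGrowthC11 (C + D) fun p => h p + k p := by
  have hd : ∀ p, fderiv ℝ (fun p => h p + k p) p = fderiv ℝ h p + fderiv ℝ k p :=
    fun p => fderiv_fun_add (hh.differentiable p) (hk.differentiable p)
  refine ⟨hh.differentiable.add hk.differentiable, fun p => ?_, fun p q => ?_⟩
  · rw [hd]
    refine (norm_add_le _ _).trans ?_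
    linarith [hh.norm_fderiv_le p, hk.norm_fderiv_le p]
  · rw [hd, hd, add_sub_add_comm]
    refine (norm_add_le _ _).trans ?_
    linarith [hh.fderiv_lipschitz p q, hk.fderiv_lipschitz p q]

theorem exists_sum {ι : Type*} (s : Finset ι) {h : ι → E → ℝ}
    (hh : ∀ i, ∃ C, LinearGrowthC11 C (h i)) :
    ∃ C, LinearGrowthC11 C fun p => ∑ i ∈ s, h i p := by
  classical
  induction s using Finset.induction_on with
  | empty => simpa using ⟨_, zero⟩
  | insert i s hi ih =>
    obtain ⟨C, hC⟩ := hh i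
    obtain ⟨D, hD⟩ := ih
    simp only [Finset.sum_insert hi]
    exact ⟨_, hC.add hD⟩

theorem nonneg (hh : LinearGrowthC11 C h) : 0 ≤ C := by
  have := (norm_nonneg _).trans (hh.norm_fderiv_le 0)
  simpa using this

/-- The mean value inequality on the ball of radius `‖p‖` gives quadratic growth, hence square
integrability under the Gaussian. -/
theorem abs_le (hh : LinearGrowthC11 C h) (p : E) : |h p| ≤ (|h 0| + C) * (1 + ‖p‖) ^ 2 := by
  have hC := hh.nonneg
  have h1 := Convex.norm_image_sub_le_of_norm_fderiv_le (f := h) (𝕜 := ℝ)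
    (s := Metric.closedBall (0 : E) ‖p‖) (C := C * (1 + ‖p‖))
    (fun x _ => hh.differentiable x) (fun x hx => (hh.norm_fderiv_le x).trans (by
      rw [mem_closedBall_zero_iff] at hx
      gcongr)) (convex_closedBall _ _)
    (Metric.mem_closedBall_self (norm_nonneg p)) (mem_closedBall_zero_iff.2 le_rfl)
  rw [Real.norm_eq_abs, sub_zero] at h1
  have h2 : |h p| ≤ |h 0| + |h p - h 0| := by
    have := abs_add_le (h 0) (h p - h 0)
    simpa using this
  have h3 : 0 ≤ |h 0| * ‖p‖ := by positivity
  have h4 : 0 ≤ |h 0| * ‖p‖ ^ 2 := by positivity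
  have h5 : 0 ≤ C * ‖p‖ := by positivity
  nlinarith

end LinearGrowthC11

end Calculus

/-! ### The derivative estimates in terms of gradients. -/

section Gradient

variable {E : Type*} [NormedAddCommGroup E] [InnerProductSpace ℝ E] [CompleteSpace E] {C : ℝ}
  {h : E → ℝ}

namespace LinearGrowthC11

theorem hasGradientAt (hh : LinearGrowthC11 C h) (p : E) : HasGradientAt h (gradient h p) p :=
  (hh.differentiable p).hasGradientAt

theorem norm_gradient_le (hh : LinearGrowthC11 C h) (p : E) : ‖gradient h p‖ ≤ C * (1 + ‖p‖) := by
  rw [gradient, LinearIsometryEquiv.norm_map]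
  exact hh.norm_fderiv_le p

theorem gradient_lipschitz (hh : LinearGrowthC11 C h) (p q : E) :
    ‖gradient h p - gradient h q‖ ≤ C * (1 + ‖p‖ + ‖q‖) * ‖p - q‖ := by
  rw [gradient, gradient, ← map_sub, LinearIsometryEquiv.norm_map]
  exact hh.fderiv_lipschitz p q

theorem locallyLipschitz_gradient (hh : LinearGrowthC11 C h) : LocallyLipschitz (gradient h) := by
  intro p
  have hC := hh.nonneg
  refine ⟨(C * (1 + (‖p‖ + 1) + (‖p‖ + 1))).toNNReal, Metric.closedBall p 1,
    Metric.closedBall_mem_nhds p one_pos, LipschitzOnWith.of_dist_le_mul fun q hq r hr => ?_⟩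
  have hb : ∀ q ∈ Metric.closedBall p 1, ‖q‖ ≤ ‖p‖ + 1 := fun q hq => by
    have := norm_le_norm_add_norm_sub' q p
    rw [Metric.mem_closedBall, dist_eq_norm] at hq
    linarith
  rw [Real.coe_toNNReal _ (by positivity), dist_eq_norm, dist_eq_norm]
  refine (hh.gradient_lipschitz q r).trans ?_
  gcongr
  exacts [hb q hq, hb r hr]

theorem continuous_gradient (hh : LinearGrowthC11 C h) : Continuous (gradient h) :=
  hh.locallyLipschitz_gradient.continuous

end LinearGrowthC11

end Gradient

/-! ### Regularity of the decision function. -/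

section Sigmoid

/-- Only the derivative bound needs an argument. As `s` takes values in `[0, 1]`, some point of `(p,
p + 1)` has slope at most `1` in absolute value, and the Lipschitz constant `K` carries this to `p`
at cost `K`. -/
theorem IsSigmoidLike.exists_boundedC11_decision {s : ℝ → ℝ} (hs : IsSigmoidLike s) (α : ℝ) :
    ∃ C, BoundedC11 C (decision s α) := by
  obtain ⟨K, hK⟩ := hs.lipschitz_deriv
  have hbd : ∀ p, |deriv s p| ≤ 1 + K := by
    intro p
    obtain ⟨c, hc, hc'⟩ := exists_deriv_eq_slope s (lt_add_one p)
      hs.differentiable.continuous.continuousOn hs.differentiable.differentiableOn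
    have h1 : |deriv s c| ≤ 1 := by
      rw [hc', add_sub_cancel_left, div_one, abs_le]
      have h2 := hs.mem_Icc p
      have h3 := hs.mem_Icc (p + 1)
      constructor <;> linarith [h2.1, h2.2, h3.1, h3.2]
    have h2 : |deriv s p - deriv s c| ≤ K := by
      have h3 := hK.dist_le_mul p c
      rw [Real.dist_eq, Real.dist_eq] at h3
      refine h3.trans (mul_le_of_le_one_right K.2 ?_)
      rw [abs_le]
      constructor <;> linarith [hc.1, hc.2]
    have h3 := abs_add_le (deriv s c) (deriv s p - deriv s c)
    rw [add_sub_cancel] at h3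
    linarith
  have hs' : BoundedC11 (1 + K) s := by
    refine ⟨hs.differentiable, fun p => ?_, fun p => ?_, fun p q => ?_⟩
    · have := hs.mem_Icc p
      rw [abs_of_nonneg this.1]
      linarith [this.2, K.2]
    · rw [← norm_deriv_eq_norm_fderiv]
      exact hbd p
    · have h1 : fderiv ℝ s p - fderiv ℝ s q = ContinuousLinearMap.toSpanSingleton ℝ
          (deriv s p - deriv s q) := by
        ext
        simp
      rw [h1, ContinuousLinearMap.norm_toSpanSingleton]
      have h3 := hK.dist_le_mul p q
      rw [dist_eq_norm, dist_eq_norm] at h3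
      refine h3.trans ?_
      gcongr
      linarith
  exact hs'.exists_comp_clm (ContinuousLinearMap.mul ℝ ℝ α)

end Sigmoid

/-! ### Ensembles as scaled sums over parameter blocks, and stability of their kernel. -/

section Ensemble

variable {J : Type*} [Fintype J]

/-- The parameter of an ensemble of `M` members as the family of the parameters of its members. -/
def blocks (J : Type*) [Fintype J] (M : ℕ) :
    EuclideanSpace ℝ (Fin M × J) ≃ₗᵢ[ℝ] PiLp 2 (fun _ : Fin M => EuclideanSpace ℝ J) :=
  LinearEquiv.isometryOfInner
    { toFun := fun θ => WithLp.toLp 2 fun m => WithLp.toLp 2 fun j => θ (m, j)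
      invFun := fun a => WithLp.toLp 2 fun k => a k.1 k.2
      map_add' := fun _ _ => rfl
      map_smul' := fun _ _ => rfl
      left_inv := fun _ => rfl
      right_inv := fun _ => rfl }
    fun θ θ' => by
      simp only [PiLp.inner_apply, Fintype.sum_prod_type]
      rfl

variable {M : ℕ}

/-- The parameter of the `m`-th member of an ensemble, as a continuous linear map. -/
def blockCLM (m : Fin M) : EuclideanSpace ℝ (Fin M × J) →L[ℝ] EuclideanSpace ℝ J :=
  (PiLp.proj 2 (fun _ : Fin M => EuclideanSpace ℝ J) m).comp
    ((blocks J M).toContinuousLinearEquiv : EuclideanSpace ℝ (Fin M × J) →L[ℝ] _)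

theorem norm_blocks_apply_le (θ : EuclideanSpace ℝ (Fin M × J)) (m : Fin M) :
    ‖blocks J M θ m‖ ≤ ‖θ‖ := by
  rw [← (blocks J M).norm_map θ]
  exact PiLp.norm_apply_le _ _

theorem sum_norm_blocks_sq (θ : EuclideanSpace ℝ (Fin M × J)) :
    ∑ m, ‖blocks J M θ m‖ ^ 2 = ‖θ‖ ^ 2 := by
  rw [← (blocks J M).norm_map θ, PiLp.norm_sq_eq_of_L2]

/-- The sum of the values of `g` at the members of an ensemble, with the `1 / √M` scaling. -/
def average (g : EuclideanSpace ℝ J → ℝ) (θ : EuclideanSpace ℝ (Fin M × J)) : ℝ :=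
  (1 / √M) * ∑ m, g (blocks J M θ m)

/-- The gradient of `average g`. -/
def averageGrad (g : EuclideanSpace ℝ J → ℝ) (θ : EuclideanSpace ℝ (Fin M × J)) :
    EuclideanSpace ℝ (Fin M × J) :=
  (blocks J M).symm (WithLp.toLp 2 fun m => (1 / √M) • gradient g (blocks J M θ m))

/-- The tangent kernel of `average`. -/
def averageKernel (g h : EuclideanSpace ℝ J → ℝ) (θ : EuclideanSpace ℝ (Fin M × J)) : ℝ :=
  (1 / (M : ℝ)) * ∑ m, inner ℝ (gradient g (blocks J M θ m)) (gradient h (blocks J M θ m))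

theorem inner_averageGrad (g h : EuclideanSpace ℝ J → ℝ) (θ : EuclideanSpace ℝ (Fin M × J)) :
    inner ℝ (averageGrad g θ) (averageGrad h θ) = averageKernel g h θ := by
  have hM : (√M)⁻¹ * (√M)⁻¹ = (M : ℝ)⁻¹ := by
    rw [← mul_inv, Real.mul_self_sqrt (Nat.cast_nonneg M)]
  rw [averageGrad, averageGrad, LinearIsometryEquiv.inner_map_map, PiLp.inner_apply, averageKernel,
    Finset.mul_sum]
  refine Finset.sum_congr rfl fun m _ => ?_
  simp only [real_inner_smul_left, real_inner_smul_right, one_div]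
  rw [← mul_assoc, hM]

theorem hasGradientAt_average {g : EuclideanSpace ℝ J → ℝ} (hg : Differentiable ℝ g)
    (θ : EuclideanSpace ℝ (Fin M × J)) : HasGradientAt (average g) (averageGrad g θ) θ := by
  rw [hasGradientAt_iff_hasFDerivAt]
  have h1 : ∀ m : Fin M, HasFDerivAt (fun θ => g (blocks J M θ m))
      ((fderiv ℝ g (blocks J M θ m)).comp (blockCLM m)) θ := fun m =>
    (hg (blockCLM m θ)).hasFDerivAt.comp θ (blockCLM m).hasFDerivAt
  have h2 := (HasFDerivAt.fun_sum (u := Finset.univ) fun m _ => h1 m).const_mul (1 / √M)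
  refine h2.congr_fderiv ?_
  ext v
  have h3 : inner ℝ (averageGrad g θ) v = inner ℝ (WithLp.toLp 2 fun m => (1 / √M) •
      gradient g (blocks J M θ m)) (blocks J M v) := by
    rw [averageGrad, ← (blocks J M).inner_map_map, LinearIsometryEquiv.apply_symm_apply]
  rw [InnerProductSpace.toDual_apply_apply, h3, PiLp.inner_apply]
  simp only [smul_apply, sum_apply, smul_eq_mul,
    Finset.mul_sum, real_inner_smul_left, inner_gradient_left]
  rfl

variable {C : ℝ} {g h : EuclideanSpace ℝ J → ℝ}

theorem LocallyLipschitz.pi {α ι : Type*} [Fintype ι] [PseudoEMetricSpace α] {β : ι → Type*}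
    [∀ i, PseudoEMetricSpace (β i)] {f : ∀ i, α → β i} (hf : ∀ i, LocallyLipschitz (f i)) :
    LocallyLipschitz fun a i => f i a := by
  intro a
  choose K t ht hK using fun i => hf i a
  refine ⟨Finset.univ.sup K, ⋂ i, t i, (Filter.iInter_mem).2 ht, fun p hp q hq => ?_⟩
  refine edist_pi_le_iff.2 fun i => ?_
  refine (hK i (Set.mem_iInter.1 hp i) (Set.mem_iInter.1 hq i)).trans ?_
  gcongr
  exact_mod_cast Finset.le_sup (f := K) (Finset.mem_univ i)

theorem locallyLipschitz_averageGrad (hg : LinearGrowthC11 C g) :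
    LocallyLipschitz (averageGrad g : EuclideanSpace ℝ (Fin M × J) → _) := by
  have h0 : ∀ m, LocallyLipschitz fun θ : EuclideanSpace ℝ (Fin M × J) => blocks J M θ m :=
    fun m => (blockCLM (J := J) m).lipschitz.locallyLipschitz
  have h1 : LocallyLipschitz fun (θ : EuclideanSpace ℝ (Fin M × J)) (m : Fin M) =>
      (1 / √(M : ℝ)) • gradient g (blocks J M θ m) := LocallyLipschitz.pi fun m =>
    (lipschitzWith_smul (1 / √(M : ℝ))).locallyLipschitz.comp
      (hg.locallyLipschitz_gradient.comp (h0 m))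
  have h2 : LocallyLipschitz (WithLp.toLp 2 : (Fin M → EuclideanSpace ℝ J) → _) :=
    (PiLp.lipschitzWith_toLp 2 fun _ : Fin M => EuclideanSpace ℝ J).locallyLipschitz
  exact (blocks J M).symm.lipschitz.locallyLipschitz.comp (h2.comp h1)

theorem locallyLipschitz_average (hg : LinearGrowthC11 C g) :
    LocallyLipschitz (average g : EuclideanSpace ℝ (Fin M × J) → ℝ) := by
  have hd : ∀ θ : EuclideanSpace ℝ (Fin M × J), HasFDerivAt (average g)
      (InnerProductSpace.toDual ℝ _ (averageGrad g θ)) θ := fun θ =>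
    (hasGradientAt_average hg.differentiable θ).hasFDerivAt
  refine ContDiff.locallyLipschitz (𝕂 := ℝ) ?_
  rw [contDiff_one_iff_fderiv]
  refine ⟨fun θ => (hd θ).differentiableAt, ?_⟩
  rw [show fderiv ℝ (average g) = fun θ : EuclideanSpace ℝ (Fin M × J) =>
    InnerProductSpace.toDual ℝ _ (averageGrad g θ) from funext fun θ => (hd θ).fderiv]
  exact (LinearIsometryEquiv.continuous _).comp (locallyLipschitz_averageGrad hg).continuous

/-- With `a = 1 + ‖q‖` and `d = ‖p - q‖` the growth bounds give `C² d (2a + d)²`, and `(2a + d)² ≤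
8a² + 2d²`. The term linear in `d` is left for Cauchy–Schwarz, the cubic one is summed directly. -/
theorem abs_inner_gradient_sub_le (hg : LinearGrowthC11 C g) (hh : LinearGrowthC11 C h)
    (p q : EuclideanSpace ℝ J) :
    |inner ℝ (gradient g p) (gradient h p) - inner ℝ (gradient g q) (gradient h q)| ≤
      C ^ 2 * (8 * (1 + ‖q‖) ^ 2 * ‖p - q‖ + 2 * ‖p - q‖ ^ 3) := by
  have hC := hg.nonneg
  set a := 1 + ‖q‖ with ha
  set d := ‖p - q‖ with hd
  have ha0 : 0 ≤ a := by positivity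
  have hd0 : 0 ≤ d := norm_nonneg _
  have hp : ‖p‖ ≤ ‖q‖ + d := norm_le_norm_add_norm_sub' p q
  have e : inner ℝ (gradient g p) (gradient h p) - inner ℝ (gradient g q) (gradient h q) =
      inner ℝ (gradient g p - gradient g q) (gradient h p) +
        inner ℝ (gradient g q) (gradient h p - gradient h q) := by
    rw [inner_sub_left, inner_sub_right]; ring
  have hlip : ∀ {k : EuclideanSpace ℝ J → ℝ}, LinearGrowthC11 C k →
      ‖gradient k p - gradient k q‖ ≤ C * (2 * a + d) * d := fun hk => by
    refine (hk.gradient_lipschitz p q).trans ?_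
    refine mul_le_mul_of_nonneg_right (mul_le_mul_of_nonneg_left ?_ hC) hd0
    linarith
  have h1 : ‖gradient h p‖ ≤ C * (a + d) :=
    (hh.norm_gradient_le p).trans (mul_le_mul_of_nonneg_left (by linarith) hC)
  have h2 : ‖gradient g q‖ ≤ C * a := hg.norm_gradient_le q
  calc _ ≤ ‖gradient g p - gradient g q‖ * ‖gradient h p‖ +
        ‖gradient g q‖ * ‖gradient h p - gradient h q‖ := by
        rw [e]
        exact (abs_add_le _ _).trans (add_le_add (abs_real_inner_le_norm _ _)
          (abs_real_inner_le_norm _ _))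
    _ ≤ (C * (2 * a + d) * d) * (C * (a + d)) + (C * a) * (C * (2 * a + d) * d) := by
        gcongr
        exacts [hlip hg, hlip hh]
    _ = C ^ 2 * (d * (2 * a + d) ^ 2) := by ring
    _ ≤ _ := by
        gcongr
        nlinarith [mul_nonneg hd0 (sq_nonneg (2 * a - d))]

/-- Since `∑ d m ^ 2 ≤ R ^ 2`, Cauchy–Schwarz and the fourth moments give `∑ a m ^ 2 * d m ≤ √M √K
R`, while `∑ d m ^ 3 ≤ R ^ 3 ≤ √M R ^ 3`. The prefactor `1 / M` leaves `1 / √M`. -/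
theorem abs_averageKernel_sub_le (hM : 0 < M) (hg : LinearGrowthC11 C g)
    (hh : LinearGrowthC11 C h) {θ θ₀ : EuclideanSpace ℝ (Fin M × J)} {R K : ℝ}
    (hK : (1 / (M : ℝ)) * ∑ m, (1 + ‖blocks J M θ₀ m‖) ^ 4 ≤ K)
    (hθ : θ ∈ Metric.closedBall θ₀ R) :
    |averageKernel g h θ - averageKernel g h θ₀| ≤
      C ^ 2 * (8 * √K * R + 2 * R ^ 3) / √M := by
  have hM' : (0 : ℝ) < M := by exact_mod_cast hM
  have hM1 : (1 : ℝ) ≤ M := by exact_mod_cast hM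
  rw [Metric.mem_closedBall, dist_eq_norm] at hθ
  have hR0 : 0 ≤ R := (norm_nonneg _).trans hθ
  set a : Fin M → ℝ := fun m => 1 + ‖blocks J M θ₀ m‖ with ha
  set d : Fin M → ℝ := fun m => ‖blocks J M θ m - blocks J M θ₀ m‖ with hd
  have hd0 : ∀ m, 0 ≤ d m := fun m => norm_nonneg _
  have hdeq : ∀ m, d m = ‖blocks J M (θ - θ₀) m‖ := fun m => by rw [map_sub, PiLp.sub_apply]
  have hd2 : ∑ m, d m ^ 2 ≤ R ^ 2 := by
    simp only [hdeq]
    rw [sum_norm_blocks_sq]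
    gcongr
  have hdR : ∀ m, d m ≤ R := fun m => by
    rw [hdeq]
    exact (norm_blocks_apply_le _ m).trans hθ
  have hd3 : ∑ m, d m ^ 3 ≤ R ^ 3 := by
    calc ∑ m, d m ^ 3 ≤ ∑ m, R * d m ^ 2 := Finset.sum_le_sum fun m _ => by
          have := mul_le_mul_of_nonneg_right (hdR m) (sq_nonneg (d m))
          calc d m ^ 3 = d m * d m ^ 2 := by ring
            _ ≤ _ := this
      _ = R * ∑ m, d m ^ 2 := by rw [Finset.mul_sum]
      _ ≤ R * R ^ 2 := by gcongr
      _ = R ^ 3 := by ring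
  have ha4 : ∑ m, a m ^ 4 ≤ M * K := by
    rw [one_div, inv_mul_le_iff₀ hM'] at hK
    exact hK
  have hcs : ∑ m, a m ^ 2 * d m ≤ √M * √K * R := by
    have h1 := Finset.sum_mul_sq_le_sq_mul_sq Finset.univ (fun m => a m ^ 2) d
    have h2 : (∑ m, a m ^ 2 * d m) ^ 2 ≤ (M * K) * R ^ 2 := by
      refine h1.trans ?_
      have : ∑ m, (a m ^ 2) ^ 2 = ∑ m, a m ^ 4 := by simp only [← pow_mul]
      rw [this]
      have h0 : 0 ≤ ∑ m, a m ^ 4 := Finset.sum_nonneg fun m _ => by positivity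
      exact mul_le_mul ha4 hd2 (Finset.sum_nonneg fun m _ => by positivity) (h0.trans ha4)
    refine (Real.le_sqrt_of_sq_le h2).trans ?_
    rw [Real.sqrt_mul' _ (sq_nonneg R), Real.sqrt_sq hR0, Real.sqrt_mul hM'.le]
  rw [averageKernel, averageKernel, ← mul_sub, ← Finset.sum_sub_distrib, abs_mul,
    abs_of_nonneg (by positivity : (0 : ℝ) ≤ 1 / M)]
  have hsM : 0 < √(M : ℝ) := Real.sqrt_pos.2 hM'
  have hsM1 : 1 ≤ √(M : ℝ) := Real.one_le_sqrt.2 hM1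
  have hsq : √(M : ℝ) * √M = M := Real.mul_self_sqrt hM'.le
  calc _ ≤ 1 / (M : ℝ) * ∑ m, C ^ 2 * (8 * a m ^ 2 * d m + 2 * d m ^ 3) := by
        gcongr
        refine (Finset.abs_sum_le_sum_abs _ _).trans (Finset.sum_le_sum fun m _ => ?_)
        exact abs_inner_gradient_sub_le hg hh _ _
    _ = 1 / (M : ℝ) * (C ^ 2 * (8 * ∑ m, a m ^ 2 * d m + 2 * ∑ m, d m ^ 3)) := by
        simp only [Finset.mul_sum, Finset.sum_add_distrib, mul_add, mul_assoc]
    _ ≤ 1 / (M : ℝ) * (C ^ 2 * (8 * (√M * √K * R) + 2 * (√M * R ^ 3))) := by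
        gcongr
        exact hd3.trans (le_mul_of_one_le_left (by positivity) hsM1)
    _ = _ := by
        nth_rewrite 1 [← hsq]
        field_simp

end Ensemble

/-! ### Gaussian initialization: independence of blocks, moments and concentration. -/

section Gaussian

variable {J : Type*} [Fintype J]

/-- Full support turns a continuous nonnegative integrand that is nonzero at one point into a
positive integral. -/
instance isOpenPosMeasure_stdGaussian :
    (stdGaussian (EuclideanSpace ℝ J)).IsOpenPosMeasure := by
  have : (gaussianReal 0 1).IsOpenPosMeasure :=
    (gaussianReal_absolutelyContinuous' 0 one_ne_zero).isOpenPosMeasure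
  rw [← map_pi_eq_stdGaussian]
  exact (PiLp.continuous_toLp 2 _).isOpenPosMeasure_map (WithLp.toLp_surjective 2)

/-- Independence of the members: the characteristic functions of the blocks multiply to that of the
standard Gaussian on the product, which is preserved by the isometry `blocks`. -/
theorem measurePreserving_blocks (M : ℕ) :
    MeasurePreserving (fun θ m => blocks J M θ m) (stdGaussian (EuclideanSpace ℝ (Fin M × J)))
      (Measure.pi fun _ : Fin M => stdGaussian (EuclideanSpace ℝ J)) := by
  have h1 : (Measure.pi fun _ : Fin M => stdGaussian (EuclideanSpace ℝ J)).map (WithLp.toLp 2) =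
      stdGaussian (PiLp 2 fun _ : Fin M => EuclideanSpace ℝ J) := by
    apply Measure.ext_of_charFun
    ext u
    rw [charFun_pi, charFun_stdGaussian, ← Complex.ofReal_pow, PiLp.norm_sq_eq_of_L2]
    simp_rw [charFun_stdGaussian, ← Complex.exp_sum]
    push_cast
    rw [← Finset.sum_div, Finset.sum_neg_distrib]
  refine ⟨by fun_prop, ?_⟩
  have h2 : (fun θ m => blocks J M θ m) = WithLp.ofLp ∘ (blocks J M) := rfl
  rw [h2, ← Measure.map_map (by fun_prop) (blocks J M).continuous.measurable, stdGaussian_map, ← h1,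
    Measure.map_map (by fun_prop) (by fun_prop)]
  exact Measure.map_id

theorem memLp_norm_stdGaussian (n : ℕ) :
    MemLp (fun p => (1 + ‖p‖) ^ n) 2 (stdGaussian (EuclideanSpace ℝ J)) := by
  have h0 : MemLp (fun p : EuclideanSpace ℝ J => ‖p‖) ((n * 2 : ℕ) : ENNReal)
      (stdGaussian (EuclideanSpace ℝ J)) :=
    (IsGaussian.memLp_id _ _ (ENNReal.natCast_ne_top _)).norm
  have hconst : MemLp (fun _ : EuclideanSpace ℝ J => (1 : ℝ)) ((n * 2 : ℕ) : ENNReal)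
      (stdGaussian (EuclideanSpace ℝ J)) := memLp_const 1
  have h1 : MemLp (fun p : EuclideanSpace ℝ J => 1 + ‖p‖) ((n * 2 : ℕ) : ENNReal)
      (stdGaussian (EuclideanSpace ℝ J)) := hconst.add h0
  have h2 := h1.integrable_norm_pow'
  have hcont : Continuous fun p : EuclideanSpace ℝ J => (1 + ‖p‖) ^ n := by fun_prop
  have h3 : (fun p : EuclideanSpace ℝ J => ‖1 + ‖p‖‖ ^ (n * 2)) =
      fun p => ((1 + ‖p‖) ^ n) ^ 2 := by
    ext p
    rw [Real.norm_of_nonneg (by positivity), pow_mul]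
  rw [h3] at h2
  exact (memLp_two_iff_integrable_sq hcont.aestronglyMeasurable).2 h2

theorem memLp_two_of_abs_le {φ : EuclideanSpace ℝ J → ℝ} (hφ : Continuous φ) {c : ℝ}
    (h : ∀ p, |φ p| ≤ c * (1 + ‖p‖) ^ 2) : MemLp φ 2 (stdGaussian (EuclideanSpace ℝ J)) :=
  ((memLp_norm_stdGaussian 2).const_mul c).mono' hφ.aestronglyMeasurable (ae_of_all _ h)

/-- Chebyshev's inequality for a sum over the members of an ensemble. -/
theorem stdGaussian_abs_sum_sub_ge_le {φ : EuclideanSpace ℝ J → ℝ} (hφ : Measurable φ)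
    (hL : MemLp φ 2 (stdGaussian (EuclideanSpace ℝ J))) (M : ℕ) {c : ℝ} (hc : 0 < c) :
    stdGaussian (EuclideanSpace ℝ (Fin M × J))
      {θ | c ≤ |∑ m, φ (blocks J M θ m) - M * ∫ p, φ p ∂stdGaussian (EuclideanSpace ℝ J)|} ≤
      ENNReal.ofReal (M * variance φ (stdGaussian (EuclideanSpace ℝ J)) / c ^ 2) := by
  set μ := stdGaussian (EuclideanSpace ℝ J)
  set P := Measure.pi fun _ : Fin M => μ
  have hev : ∀ m : Fin M, MeasurePreserving (fun a : Fin M → EuclideanSpace ℝ J => a m) P μ :=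
    fun m => measurePreserving_eval (fun _ : Fin M => μ) m
  have hmem : ∀ m : Fin M, MemLp (fun a : Fin M → EuclideanSpace ℝ J => φ (a m)) 2 P :=
    fun m => hL.comp_measurePreserving (hev m)
  have hvar : variance (fun a => ∑ m, φ (a m)) P = M * variance φ μ := by
    have h1 := variance_sum_pi (μ := fun _ : Fin M => μ) (X := fun _ => φ) fun _ => hL
    have h2 : (∑ m : Fin M, fun a : Fin M → EuclideanSpace ℝ J => φ (a m)) =
        fun a => ∑ m, φ (a m) := by
      ext a
      simp
    rw [h2] at h1
    rw [h1]
    simp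
  have hint : ∫ a, ∑ m, φ (a m) ∂P = M * ∫ p, φ p ∂μ := by
    rw [integral_finsetSum _ fun m _ => (hmem m).integrable (by norm_num)]
    have : ∀ m : Fin M, ∫ a, φ (a m) ∂P = ∫ p, φ p ∂μ := fun m => by
      rw [← (hev m).map_eq, integral_map (hev m).aemeasurable
        (by rw [(hev m).map_eq]; exact hL.1)]
    simp [this]
  have hch := meas_ge_le_variance_div_sq (memLp_finsetSum Finset.univ fun m _ => hmem m) hc
  rw [hvar, hint] at hch
  refine le_trans (le_of_eq ?_) hch
  have hmeas : MeasurableSet {a : Fin M → EuclideanSpace ℝ J |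
      c ≤ |∑ m, φ (a m) - M * ∫ p, φ p ∂μ|} := measurableSet_le measurable_const (by fun_prop)
  exact (measurePreserving_blocks M).measure_preimage hmeas.nullMeasurableSet

/-- The quadratic weak law of large numbers for an average over the members of an ensemble. -/
theorem stdGaussian_abs_mean_sub_ge_le {φ : EuclideanSpace ℝ J → ℝ} (hφ : Measurable φ)
    (hL : MemLp φ 2 (stdGaussian (EuclideanSpace ℝ J))) {M : ℕ} (hM : 0 < M) {ε : ℝ} (hε : 0 < ε) :
    stdGaussian (EuclideanSpace ℝ (Fin M × J))
      {θ | ε ≤ |(1 / (M : ℝ)) * ∑ m, φ (blocks J M θ m) -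
        ∫ p, φ p ∂stdGaussian (EuclideanSpace ℝ J)|} ≤
      ENNReal.ofReal (variance φ (stdGaussian (EuclideanSpace ℝ J)) / ε ^ 2 / M) := by
  have hM' : (0 : ℝ) < M := by exact_mod_cast hM
  refine le_trans (le_of_eq ?_) ((stdGaussian_abs_sum_sub_ge_le hφ hL M
    (c := M * ε) (by positivity)).trans_eq ?_)
  · congr 1
    ext θ
    simp only [Set.mem_ofPred_eq]
    set S := ∑ m, φ (blocks J M θ m)
    set I := ∫ p, φ p ∂stdGaussian (EuclideanSpace ℝ J)
    have : S - M * I = M * (1 / (M : ℝ) * S - I) := by field_simp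
    rw [this, abs_mul, abs_of_pos hM', mul_le_mul_iff_right₀ hM']
  · congr 1
    field_simp

theorem tendsto_stdGaussian_abs_mean_sub_ge {φ : EuclideanSpace ℝ J → ℝ} (hφ : Measurable φ)
    (hL : MemLp φ 2 (stdGaussian (EuclideanSpace ℝ J))) {ε : ℝ} (hε : 0 < ε) :
    Tendsto (fun M : ℕ => stdGaussian (EuclideanSpace ℝ (Fin M × J))
      {θ | ε ≤ |(1 / (M : ℝ)) * ∑ m, φ (blocks J M θ m) -
        ∫ p, φ p ∂stdGaussian (EuclideanSpace ℝ J)|}) atTop (𝓝 0) := by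
  have h1 : Tendsto (fun M : ℕ => ENNReal.ofReal
      (variance φ (stdGaussian (EuclideanSpace ℝ J)) / ε ^ 2 / M)) atTop (𝓝 0) := by
    rw [← ENNReal.ofReal_zero]
    exact (ENNReal.continuous_ofReal.tendsto 0).comp (tendsto_const_div_atTop_nhds_zero_nat _)
  refine tendsto_of_tendsto_of_tendsto_of_le_of_le' tendsto_const_nhds h1
    (Eventually.of_forall fun _ => zero_le) ?_
  filter_upwards [eventually_gt_atTop 0] with M hM
  exact stdGaussian_abs_mean_sub_ge_le hφ hL hM hε

/-- For centred `φ` the scaling `1 / √M` cancels the growth of the variance of the sum, so the bound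
is free of `M`. -/
theorem stdGaussian_abs_average_ge_le {φ : EuclideanSpace ℝ J → ℝ} (hφ : Measurable φ)
    (hL : MemLp φ 2 (stdGaussian (EuclideanSpace ℝ J)))
    (h0 : ∫ p, φ p ∂stdGaussian (EuclideanSpace ℝ J) = 0) {M : ℕ} (hM : 0 < M) {U : ℝ}
    (hU : 0 < U) :
    stdGaussian (EuclideanSpace ℝ (Fin M × J)) {θ | U ≤ |average φ θ|} ≤
      ENNReal.ofReal (variance φ (stdGaussian (EuclideanSpace ℝ J)) / U ^ 2) := by
  have hM' : (0 : ℝ) < √M := Real.sqrt_pos.2 (by exact_mod_cast hM)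
  refine le_trans (le_of_eq ?_) ((stdGaussian_abs_sum_sub_ge_le hφ hL M
    (c := √M * U) (by positivity)).trans_eq ?_)
  · congr 1
    ext θ
    simp only [Set.mem_ofPred_eq, h0, mul_zero, sub_zero, average]
    rw [abs_mul, abs_of_pos (by positivity : 0 < 1 / √(M : ℝ)), one_div, le_inv_mul_iff₀ hM']
  · congr 1
    rw [mul_pow, Real.sq_sqrt (Nat.cast_nonneg M)]
    have : (0 : ℝ) < M := by exact_mod_cast hM
    field_simp

/-- A function that is odd under a linear isometry has mean zero. -/
theorem integral_stdGaussian_eq_zero {φ : EuclideanSpace ℝ J → ℝ}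
    (T : EuclideanSpace ℝ J ≃ₗᵢ[ℝ] EuclideanSpace ℝ J) (hT : ∀ p, φ (T p) = -φ p) :
    ∫ p, φ p ∂stdGaussian (EuclideanSpace ℝ J) = 0 := by
  have h1 : ∫ p, φ p ∂(stdGaussian (EuclideanSpace ℝ J)).map T =
      ∫ p, φ (T p) ∂stdGaussian (EuclideanSpace ℝ J) :=
    integral_map_equiv T.toHomeomorph.toMeasurableEquiv φ
  rw [stdGaussian_map] at h1
  simp only [hT, integral_neg] at h1
  linarith

end Gaussian

/-! ### Coercivity of the limiting kernel and the lazy regime. -/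

section Lazy

variable {J : Type*} [Fintype J] {N : ℕ} {C : ℝ} {g : Fin N → EuclideanSpace ℝ J → ℝ}

/-- The limiting kernel of the family `g`: the expectation of the tangent kernel of a single
member. -/
def limitKernel (g : Fin N → EuclideanSpace ℝ J → ℝ) (i j : Fin N) : ℝ :=
  ∫ p, inner ℝ (gradient (g i) p) (gradient (g j) p) ∂stdGaussian (EuclideanSpace ℝ J)

/-- The linear relations between the gradients of the family `g`. -/
def gradientRelations (g : Fin N → EuclideanSpace ℝ J → ℝ) :
    Submodule ℝ (EuclideanSpace ℝ (Fin N)) where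
  carrier := {c | ∀ p, ∑ i, c i • gradient (g i) p = 0}
  zero_mem' := fun p => by simp
  add_mem' := fun {a b} ha hb p => by
    simp only [PiLp.add_apply, add_smul, Finset.sum_add_distrib]
    rw [ha p, hb p, add_zero]
  smul_mem' := fun r a ha p => by
    simp only [PiLp.smul_apply, smul_eq_mul, mul_smul, ← Finset.smul_sum]
    rw [ha p, smul_zero]

theorem norm_sum_smul_sq {E : Type*} [NormedAddCommGroup E] [InnerProductSpace ℝ E] (c : Fin N → ℝ)
    (v : Fin N → E) : ‖∑ i, c i • v i‖ ^ 2 = ∑ i, ∑ j, c i * c j * inner ℝ (v i) (v j) := by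
  rw [← real_inner_self_eq_norm_sq, sum_inner]
  refine Finset.sum_congr rfl fun i _ => ?_
  rw [inner_sum]
  refine Finset.sum_congr rfl fun j _ => ?_
  rw [real_inner_smul_left, real_inner_smul_right]
  ring

theorem memLp_inner_gradient (hg : ∀ i, LinearGrowthC11 C (g i)) (i j : Fin N) :
    MemLp (fun p => inner ℝ (gradient (g i) p) (gradient (g j) p)) 2
      (stdGaussian (EuclideanSpace ℝ J)) := by
  refine memLp_two_of_abs_le ((hg i).continuous_gradient.inner (hg j).continuous_gradient)
    (c := C ^ 2) fun p => (abs_real_inner_le_norm _ _).trans ?_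
  have hC := (hg i).nonneg
  calc _ ≤ (C * (1 + ‖p‖)) * (C * (1 + ‖p‖)) := by
        gcongr
        exacts [(hg i).norm_gradient_le p, (hg j).norm_gradient_le p]
    _ = _ := by ring

theorem integral_norm_sum_smul_gradient_sq (hg : ∀ i, LinearGrowthC11 C (g i)) (c : Fin N → ℝ) :
    ∫ p, ‖∑ i, c i • gradient (g i) p‖ ^ 2 ∂stdGaussian (EuclideanSpace ℝ J) =
      ∑ i, ∑ j, c i * c j * limitKernel g i j := by
  have hint : ∀ i j, Integrable (fun p => c i * c j * inner ℝ (gradient (g i) p)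
      (gradient (g j) p)) (stdGaussian (EuclideanSpace ℝ J)) := fun i j =>
    ((memLp_inner_gradient hg i j).integrable (by norm_num)).const_mul _
  simp only [norm_sum_smul_sq]
  rw [integral_finsetSum _ fun i _ => integrable_finsetSum _ fun j _ => hint i j]
  refine Finset.sum_congr rfl fun i _ => ?_
  rw [integral_finsetSum _ fun j _ => hint i j]
  exact Finset.sum_congr rfl fun j _ => integral_const_mul _ _

/-- The limiting kernel is positive definite on the orthogonal complement of the linear relations
between the gradients. -/
theorem exists_pos_limitKernel_coercive (hg : ∀ i, LinearGrowthC11 C (g i)) :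
    ∃ lam : ℝ, 0 < lam ∧ ∀ c ∈ (gradientRelations g)ᗮ,
      lam * ‖c‖ ^ 2 ≤ ∑ i, ∑ j, c i * c j * limitKernel g i j := by
  set V := (gradientRelations g)ᗮ with hV
  set q : EuclideanSpace ℝ (Fin N) → ℝ := fun c => ∑ i, ∑ j, c i * c j * limitKernel g i j with hq
  have hqc : Continuous q := by fun_prop
  have hpos : ∀ c ∈ V, c ≠ 0 → 0 < q c := by
    intro c hc hc0
    have hcont : Continuous fun p => ‖∑ i, c i • gradient (g i) p‖ ^ 2 :=
      (continuous_finsetSum _ fun i _ => (hg i).continuous_gradient.const_smul (c i)).norm.pow 2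
    have hint : Integrable (fun p => ‖∑ i, c i • gradient (g i) p‖ ^ 2)
        (stdGaussian (EuclideanSpace ℝ J)) := by
      simp only [norm_sum_smul_sq]
      exact integrable_finsetSum _ fun i _ => integrable_finsetSum _ fun j _ =>
        ((memLp_inner_gradient hg i j).integrable (by norm_num)).const_mul _
    -- Otherwise `c` would lie both in the space of relations and in its orthogonal complement.
    have h1 : ∃ p, ∑ i, c i • gradient (g i) p ≠ 0 := by
      by_contra h
      push Not at h
      have hmem : c ∈ gradientRelations g := h
      have := Submodule.inner_right_of_mem_orthogonal hmem hc
      exact hc0 (inner_self_eq_zero.1 this)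
    obtain ⟨p, hp⟩ := h1
    rw [hq]
    simp only
    rw [← integral_norm_sum_smul_gradient_sq hg]
    exact integral_pos_of_integrable_nonneg_nonzero hcont hint (fun p => by positivity)
      (x := p) (by positivity)
  have hcpt : IsCompact (Metric.sphere (0 : EuclideanSpace ℝ (Fin N)) 1 ∩ V) :=
    (isCompact_sphere _ _).inter_right V.closed_of_finiteDimensional
  -- The constant is the minimum of the form on the unit sphere of `V`. If `V = 0` this sphere is
  -- empty and any positive constant serves.
  rcases (Metric.sphere (0 : EuclideanSpace ℝ (Fin N)) 1 ∩ (V : Set _)).eq_empty_or_nonempty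
    with hem | hne
  · refine ⟨1, one_pos, fun c hc => ?_⟩
    have hc0 : c = 0 := by
      by_contra h0
      have : ‖c‖⁻¹ • c ∈ Metric.sphere (0 : EuclideanSpace ℝ (Fin N)) 1 ∩ V := by
        refine ⟨?_, V.smul_mem _ hc⟩
        rw [mem_sphere_zero_iff_norm, norm_smul, norm_inv, norm_norm,
          inv_mul_cancel₀ (norm_ne_zero_iff.2 h0)]
      rw [hem] at this
      exact this
    simp [hc0]
  · obtain ⟨c₀, ⟨hc₀s, hc₀V⟩, hmin⟩ := hcpt.exists_isMinOn hne hqc.continuousOn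
    rw [mem_sphere_zero_iff_norm] at hc₀s
    refine ⟨q c₀, hpos c₀ hc₀V fun h => by simp [h] at hc₀s, fun c hc => ?_⟩
    by_cases h0 : c = 0
    · simp [h0]
    have hn : ‖c‖ ≠ 0 := norm_ne_zero_iff.2 h0
    have h1 : q c₀ ≤ q (‖c‖⁻¹ • c) := hmin ⟨by
      rw [mem_sphere_zero_iff_norm, norm_smul, norm_inv, norm_norm, inv_mul_cancel₀ hn],
      V.smul_mem _ hc⟩
    have h2 : q (‖c‖⁻¹ • c) * ‖c‖ ^ 2 = q c := by
      simp only [hq, Finset.sum_mul, PiLp.smul_apply, smul_eq_mul]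
      refine Finset.sum_congr rfl fun i _ => Finset.sum_congr rfl fun j _ => ?_
      field_simp
    calc q c₀ * ‖c‖ ^ 2 ≤ q (‖c‖⁻¹ • c) * ‖c‖ ^ 2 := by gcongr
      _ = q c := h2

theorem abs_sum_sum_mul_le (c : EuclideanSpace ℝ (Fin N)) {A : Fin N → Fin N → ℝ} {B : ℝ}
    (hB : 0 ≤ B) (hA : ∀ i j, |A i j| ≤ B) :
    |∑ i, ∑ j, c i * c j * A i j| ≤ N * B * ‖c‖ ^ 2 := by
  have h1 : |∑ i, ∑ j, c i * c j * A i j| ≤ ∑ i, ∑ j, |c i| * |c j| * B := by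
    refine (Finset.abs_sum_le_sum_abs _ _).trans (Finset.sum_le_sum fun i _ => ?_)
    refine (Finset.abs_sum_le_sum_abs _ _).trans (Finset.sum_le_sum fun j _ => ?_)
    rw [abs_mul, abs_mul]
    gcongr
    exact hA i j
  have h2 : ∑ i, ∑ j, |c i| * |c j| * B = (∑ i, |c i|) ^ 2 * B := by
    rw [sq, Finset.sum_mul_sum, Finset.sum_mul]
    simp only [Finset.sum_mul]
  have h3 : (∑ i, |c i|) ^ 2 ≤ N * ‖c‖ ^ 2 := by
    have := sq_sum_le_card_mul_sum_sq (s := Finset.univ) (f := fun i => |c i|)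
    rw [EuclideanSpace.real_norm_sq_eq]
    simpa using this
  calc _ ≤ (∑ i, |c i|) ^ 2 * B := h1.trans_eq h2
    _ ≤ N * ‖c‖ ^ 2 * B := by gcongr
    _ = _ := by ring

variable {M : ℕ}

/-- The squared loss of the averages of the family `g` with targets `y`. -/
def averageLoss (g : Fin N → EuclideanSpace ℝ J → ℝ) (y : Fin N → ℝ)
    (θ : EuclideanSpace ℝ (Fin M × J)) : ℝ :=
  (1 / 2) * ∑ i, (average (g i) θ - y i) ^ 2

/-- The gradient of `averageLoss`. -/
def averageLossGrad (g : Fin N → EuclideanSpace ℝ J → ℝ) (y : Fin N → ℝ)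
    (θ : EuclideanSpace ℝ (Fin M × J)) : EuclideanSpace ℝ (Fin M × J) :=
  ∑ i, (average (g i) θ - y i) • averageGrad (g i) θ

theorem hasGradientAt_averageLoss (hg : ∀ i, LinearGrowthC11 C (g i)) (y : Fin N → ℝ)
    (θ : EuclideanSpace ℝ (Fin M × J)) :
    HasGradientAt (averageLoss g y) (averageLossGrad g y θ) θ := by
  rw [hasGradientAt_iff_hasFDerivAt]
  have h1 : ∀ i, HasFDerivAt (fun θ => (average (g i) θ - y i) ^ 2) _ θ := fun i =>
    (((hasGradientAt_average (hg i).differentiable θ).hasFDerivAt.sub_const (y i)).pow 2)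
  refine ((HasFDerivAt.fun_sum (u := Finset.univ) fun i _ => h1 i).const_mul
    (1 / 2 : ℝ)).congr_fderiv ?_
  ext v
  simp only [averageLossGrad, map_sum, map_smul, smul_apply, sum_apply, smul_eq_mul,
    Finset.mul_sum, nsmul_eq_mul]
  refine Finset.sum_congr rfl fun i _ => ?_
  push_cast
  ring

theorem LocallyLipschitz.sub_const {α : Type*} [PseudoEMetricSpace α] {f : α → ℝ}
    (hf : LocallyLipschitz f) (c : ℝ) : LocallyLipschitz fun a => f a - c := by
  have h : LocallyLipschitz fun r : ℝ => r - c :=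
    ContDiff.locallyLipschitz (𝕂 := ℝ) (contDiff_id.sub contDiff_const)
  exact h.comp hf

theorem LocallyLipschitz.smul_fun {α E : Type*} [PseudoEMetricSpace α] [NormedAddCommGroup E]
    [NormedSpace ℝ E] {f : α → ℝ} {v : α → E} (hf : LocallyLipschitz f)
    (hv : LocallyLipschitz v) : LocallyLipschitz fun a => f a • v a := by
  have h : LocallyLipschitz fun a : ℝ × E => a.1 • a.2 :=
    ContDiff.locallyLipschitz (𝕂 := ℝ) (contDiff_fst.smul contDiff_snd)
  exact h.comp (hf.prodMk hv)

theorem LocallyLipschitz.finsetSum {α E ι : Type*} [Fintype ι] [PseudoEMetricSpace α]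
    [NormedAddCommGroup E] [NormedSpace ℝ E] {v : ι → α → E}
    (hv : ∀ i, LocallyLipschitz (v i)) : LocallyLipschitz fun a => ∑ i, v i a := by
  have h : LocallyLipschitz fun a : ι → E => ∑ i, a i :=
    ContDiff.locallyLipschitz (𝕂 := ℝ) (ContDiff.sum fun i _ => contDiff_apply ℝ E i)
  exact h.comp (LocallyLipschitz.pi hv)

theorem locallyLipschitz_averageLossGrad (hg : ∀ i, LinearGrowthC11 C (g i)) (y : Fin N → ℝ) :
    LocallyLipschitz
      (averageLossGrad g y : EuclideanSpace ℝ (Fin M × J) → EuclideanSpace ℝ (Fin M × J)) := by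
  refine LocallyLipschitz.finsetSum fun i => LocallyLipschitz.smul_fun ?_
    (locallyLipschitz_averageGrad (hg i))
  exact LocallyLipschitz.sub_const (locallyLipschitz_average (hg i)) (y i)

theorem sum_smul_averageGrad_eq_zero {c : EuclideanSpace ℝ (Fin N)} (hc : c ∈ gradientRelations g)
    (θ : EuclideanSpace ℝ (Fin M × J)) : ∑ i, c i • averageGrad (g i) θ = 0 := by
  simp only [averageGrad, ← map_smul, ← map_sum]
  rw [LinearIsometryEquiv.map_eq_zero_iff]
  ext1 m
  simp only [WithLp.ofLp_sum, Finset.sum_apply, PiLp.smul_apply, PiLp.zero_apply]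
  simp_rw [smul_comm _ (1 / √(M : ℝ)), ← Finset.smul_sum]
  rw [hc, smul_zero]

/-- A relation between the gradients says that `∑ i, c i * g i` has zero derivative, so it is
constant. This component of the predictions cannot be trained. -/
theorem sum_mul_average_eq (hg : ∀ i, LinearGrowthC11 C (g i)) {c : EuclideanSpace ℝ (Fin N)}
    (hc : c ∈ gradientRelations g) (θ θ' : EuclideanSpace ℝ (Fin M × J)) :
    ∑ i, c i * average (g i) θ = ∑ i, c i * average (g i) θ' := by
  have hconst : ∀ p q, ∑ i, c i * g i p = ∑ i, c i * g i q := by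
    have hd : ∀ p, HasFDerivAt (fun p => ∑ i, c i * g i p)
        (0 : EuclideanSpace ℝ J →L[ℝ] ℝ) p := fun p => by
      refine (HasFDerivAt.fun_sum (u := Finset.univ) fun i _ =>
        ((hg i).hasGradientAt p).hasFDerivAt.const_mul (c i)).congr_fderiv ?_
      simp only [← map_smul, ← map_sum]
      rw [hc p, map_zero]
    exact is_const_of_fderiv_eq_zero (𝕜 := ℝ) (fun p => (hd p).differentiableAt)
      fun p => (hd p).fderiv
  have h : ∀ θ : EuclideanSpace ℝ (Fin M × J), ∑ i, c i * average (g i) θ =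
      (1 / √M) * ∑ m, ∑ i, c i * g i (blocks J M θ m) := fun θ => by
    simp only [average, Finset.mul_sum]
    rw [Finset.sum_comm]
    exact Finset.sum_congr rfl fun m _ => Finset.sum_congr rfl fun i _ => by ring
  rw [h, h]
  congr 1
  exact Finset.sum_congr rfl fun m _ => hconst _ _

/-- Training in the lazy regime: if the kernel at initialization is `ε`-close to a matrix `H` that
is coercive modulo the linear relations between the gradients, and if it moves by at most `ε` on a
sufficiently large ball, then the gradient flow exists for all times and stays in this ball. -/
theorem averageLoss_gradientFlow (hg : ∀ i, LinearGrowthC11 C (g i)) (y : Fin N → ℝ)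
    {H : Fin N → Fin N → ℝ} {lam B ε U R η : ℝ} (hlam : 0 < lam) (hη : 0 < η)
    (hH : ∀ c ∈ (gradientRelations g)ᗮ, lam * ‖c‖ ^ 2 ≤ ∑ i, ∑ j, c i * c j * H i j)
    (hB : 0 ≤ B) (hHB : ∀ i j, |H i j| ≤ B) (hε : 0 ≤ ε) (hεN : N * (2 * ε) ≤ lam / 2)
    (hε1 : 2 * ε ≤ 1) (hR : √(2 * (N * (B + 1))) * √(N * U ^ 2) / (lam / 2) < R)
    {θ₀ : EuclideanSpace ℝ (Fin M × J)} (hU : ∀ i, |average (g i) θ₀ - y i| ≤ U)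
    (hinit : ∀ i j, |averageKernel (g i) (g j) θ₀ - H i j| ≤ ε)
    (hball : ∀ θ ∈ Metric.closedBall θ₀ R, ∀ i j,
      |averageKernel (g i) (g j) θ - averageKernel (g i) (g j) θ₀| ≤ ε) :
    (∃ γ : ℝ → EuclideanSpace ℝ (Fin M × J), γ 0 = θ₀ ∧ ∀ τ, 0 ≤ τ →
      HasDerivWithinAt γ (-η • averageLossGrad g y (γ τ)) (Set.Ici 0) τ) ∧
    ∀ γ : ℝ → EuclideanSpace ℝ (Fin M × J), γ 0 = θ₀ → (∀ τ, 0 ≤ τ →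
      HasDerivWithinAt γ (-η • averageLossGrad g y (γ τ)) (Set.Ici 0) τ) →
      ∀ τ, 0 ≤ τ → γ τ ∈ Metric.closedBall θ₀ R := by
  set W := gradientRelations g with hW
  set r : EuclideanSpace ℝ (Fin M × J) → EuclideanSpace ℝ (Fin N) := fun θ =>
    WithLp.toLp 2 fun i => average (g i) θ - y i with hr
  -- `k` is the untrainable part of the residual and `u θ = r θ - k ∈ Wᗮ` the trainable one.
  set k := W.starProjection (r θ₀) with hk
  have hkW : k ∈ W := W.starProjection_apply_mem _
  set u : EuclideanSpace ℝ (Fin M × J) → EuclideanSpace ℝ (Fin N) := fun θ => r θ - k with hu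
  have huV : ∀ θ, u θ ∈ Wᗮ := by
    intro θ
    have h1 : u θ₀ ∈ Wᗮ := W.sub_starProjection_mem_orthogonal _
    have h2 : r θ - r θ₀ ∈ Wᗮ := by
      rw [Submodule.mem_orthogonal']
      intro c hc
      have := sum_mul_average_eq hg hc θ θ₀
      simp only [PiLp.inner_apply, hr, PiLp.sub_apply]
      simp only [RCLike.inner_apply, conj_trivial]
      rw [← sub_eq_zero, ← Finset.sum_sub_distrib] at this
      rw [← this]
      exact Finset.sum_congr rfl fun i _ => by ring
    have : u θ = (r θ - r θ₀) + u θ₀ := by simp only [hu]; abel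
    rw [this]
    exact Wᗮ.add_mem h2 h1
  have hloss : ∀ θ, averageLoss g y θ = 1 / 2 * ‖r θ‖ ^ 2 := fun θ => by
    rw [EuclideanSpace.real_norm_sq_eq]; rfl
  have hpyth : ∀ θ, ‖r θ‖ ^ 2 = ‖u θ‖ ^ 2 + ‖k‖ ^ 2 := fun θ => by
    have h1 : r θ = u θ + k := by simp only [hu]; abel
    have h2 : inner ℝ (u θ) k = 0 := Submodule.inner_left_of_mem_orthogonal hkW (huV θ)
    rw [h1, norm_add_sq_real, h2]
    ring
  have hgrad : ∀ θ, averageLossGrad g y θ = ∑ i, u θ i • averageGrad (g i) θ := fun θ => by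
    have h1 : ∀ i, u θ i = (average (g i) θ - y i) - k i := fun i => rfl
    simp only [h1, sub_smul (average _ _ - _), Finset.sum_sub_distrib]
    rw [sum_smul_averageGrad_eq_zero hkW, sub_zero, averageLossGrad]
  have hnorm : ∀ θ, ‖averageLossGrad g y θ‖ ^ 2 =
      ∑ i, ∑ j, u θ i * u θ j * averageKernel (g i) (g j) θ := fun θ => by
    rw [hgrad, norm_sum_smul_sq]
    simp only [inner_averageGrad]
  -- Removing the constant `‖k‖² / 2` keeps the gradient and leaves `ℓ = ‖u‖² / 2`, which can
  -- satisfy the lower inequality even when the loss has a positive infimum.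
  set ℓ : EuclideanSpace ℝ (Fin M × J) → ℝ := fun θ => averageLoss g y θ - 1 / 2 * ‖k‖ ^ 2 with hℓ
  have hℓu : ∀ θ, ℓ θ = 1 / 2 * ‖u θ‖ ^ 2 := fun θ => by
    simp only [hℓ, hloss, hpyth]; ring
  have hℓ0 : ∀ θ, 0 ≤ ℓ θ := fun θ => by rw [hℓu]; positivity
  have hℓg : ∀ θ, HasGradientAt ℓ (averageLossGrad g y θ) θ := fun θ => by
    have := (hasGradientAt_averageLoss hg y θ).hasFDerivAt.sub_const (1 / 2 * ‖k‖ ^ 2)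
    exact hasGradientAt_iff_hasFDerivAt.2 this
  have hclose : ∀ θ ∈ Metric.closedBall θ₀ R, ∀ i j,
      |averageKernel (g i) (g j) θ - H i j| ≤ 2 * ε := fun θ hθ i j => by
    have := abs_sub_le (averageKernel (g i) (g j) θ) (averageKernel (g i) (g j) θ₀) (H i j)
    linarith [hball θ hθ i j, hinit i j]
  -- Coercivity of `H` on `Wᗮ` gives `lam`. The kernel differs from `H` by at most `2ε` per entry,
  -- which costs at most `N * (2 * ε) ≤ lam / 2`, so `μ = lam / 2`.
  have hlow : ∀ θ ∈ Metric.closedBall θ₀ R,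
      2 * (lam / 2) * ℓ θ ≤ ‖averageLossGrad g y θ‖ ^ 2 := fun θ hθ => by
    have h1 := abs_sum_sum_mul_le (u θ) (by positivity) (hclose θ hθ)
    have h2 := hH _ (huV θ)
    have h3 : ∑ i, ∑ j, u θ i * u θ j * (averageKernel (g i) (g j) θ - H i j) =
        ‖averageLossGrad g y θ‖ ^ 2 - ∑ i, ∑ j, u θ i * u θ j * H i j := by
      rw [hnorm]
      simp only [mul_sub, Finset.sum_sub_distrib]
    rw [h3, abs_le] at h1
    have h4 := mul_le_mul_of_nonneg_right hεN (sq_nonneg ‖u θ‖)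
    rw [hℓu]
    linarith [h1.1]
  have hupp : ∀ θ ∈ Metric.closedBall θ₀ R,
      ‖averageLossGrad g y θ‖ ^ 2 ≤ √(2 * (N * (B + 1))) ^ 2 * ℓ θ := fun θ hθ => by
    have h1 : ∀ i j, |averageKernel (g i) (g j) θ| ≤ B + 1 := fun i j => by
      have := abs_sub_abs_le_abs_sub (averageKernel (g i) (g j) θ) (H i j)
      linarith [hclose θ hθ i j, hHB i j]
    rw [hnorm, Real.sq_sqrt (by positivity), hℓu]
    refine (le_abs_self _).trans ((abs_sum_sum_mul_le (u θ) (by positivity) h1).trans_eq ?_)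
    ring
  have hstart : √(ℓ θ₀) ≤ √(N * U ^ 2) := by
    refine Real.sqrt_le_sqrt ?_
    have h1 : ℓ θ₀ ≤ averageLoss g y θ₀ := by
      simp only [hℓ]
      linarith [sq_nonneg ‖k‖]
    have h2 : ∑ i, (average (g i) θ₀ - y i) ^ 2 ≤ ∑ _i : Fin N, U ^ 2 :=
      Finset.sum_le_sum fun i _ => sq_le_sq.2 ((hU i).trans (le_abs_self U))
    have h3 : 0 ≤ ∑ i, (average (g i) θ₀ - y i) ^ 2 := Finset.sum_nonneg fun i _ => sq_nonneg _
    simp only [Finset.sum_const, Finset.card_univ, Fintype.card_fin, nsmul_eq_mul] at h2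
    rw [averageLoss] at h1
    linarith
  have hR' : √(2 * (N * (B + 1))) * √(ℓ θ₀) / (lam / 2) < R := lt_of_le_of_lt (by gcongr) hR
  refine ⟨exists_gradientFlow hℓg (locallyLipschitz_averageLossGrad hg y) hℓ0 hη (by positivity)
    (Real.sqrt_nonneg _) hR' hlow hupp, fun γ h0 hγ τ hτ => ?_⟩
  exact gradientFlow_mem_closedBall hℓg hℓ0 hη (by positivity) (Real.sqrt_nonneg _) hR' hlow hupp
    (v := fun θ => -η • averageLossGrad g y θ) (fun _ _ => rfl) h0 hγ hτ

end Lazy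

/-! ### The soft tree as an ensemble member. -/

section Tree

variable {t : BinaryTree Unit} {F M N : ℕ}

/-- The prediction of a single tree, as a function of its own parameter. -/
def singleTree (σ : ℝ → ℝ) (x : EuclideanSpace ℝ (Fin F))
    (p : EuclideanSpace ℝ (Node t × Fin F ⊕ Leaf t)) : ℝ :=
  ∑ ℓ : Leaf t, p (Sum.inr ℓ) * ∏ n : Node t,
    (if inLeft t ℓ n then σ (∑ k, p (Sum.inl (n, k)) * x k) else 1) *
    (if inRight t ℓ n then 1 - σ (∑ k, p (Sum.inl (n, k)) * x k) else 1)

theorem ensemble_eq_average (σ : ℝ → ℝ) (x : EuclideanSpace ℝ (Fin F)) :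
    (fun θ : Params t F M => ensemble σ θ x) = average (singleTree σ x) := rfl

theorem exists_linearGrowthC11_singleTree {σ : ℝ → ℝ} (hσ : ∃ C, BoundedC11 C σ)
    (x : EuclideanSpace ℝ (Fin F)) :
    ∃ C, LinearGrowthC11 C (singleTree (t := t) σ x) := by
  obtain ⟨C, hC⟩ := hσ
  have hσn : ∀ n : Node t, ∃ D, BoundedC11 D
      fun p : EuclideanSpace ℝ (Node t × Fin F ⊕ Leaf t) =>
        σ (∑ k, p (Sum.inl (n, k)) * x k) := fun n => by
    have := hC.exists_comp_clm (∑ k, x k • EuclideanSpace.proj (𝕜 := ℝ)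
      (Sum.inl (n, k) : Node t × Fin F ⊕ Leaf t))
    simpa [sum_apply, mul_comm] using this
  refine LinearGrowthC11.exists_sum Finset.univ fun ℓ => ?_
  obtain ⟨D, hD⟩ := BoundedC11.exists_prod Finset.univ (h := fun (n : Node t)
    (p : EuclideanSpace ℝ (Node t × Fin F ⊕ Leaf t)) =>
      (if inLeft t ℓ n then σ (∑ k, p (Sum.inl (n, k)) * x k) else 1) *
      (if inRight t ℓ n then 1 - σ (∑ k, p (Sum.inl (n, k)) * x k) else 1)) fun n => by
    obtain ⟨D, hD⟩ := hσn n
    have h1 : ∃ D, BoundedC11 D fun p : EuclideanSpace ℝ (Node t × Fin F ⊕ Leaf t) =>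
        if inLeft t ℓ n then σ (∑ k, p (Sum.inl (n, k)) * x k) else 1 := by
      split_ifs
      exacts [⟨D, hD⟩, ⟨_, BoundedC11.const 1⟩]
    have h2 : ∃ D, BoundedC11 D fun p : EuclideanSpace ℝ (Node t × Fin F ⊕ Leaf t) =>
        if inRight t ℓ n then 1 - σ (∑ k, p (Sum.inl (n, k)) * x k) else 1 := by
      split_ifs
      exacts [⟨_, hD.one_sub⟩, ⟨_, BoundedC11.const 1⟩]
    obtain ⟨D₁, h1⟩ := h1
    obtain ⟨D₂, h2⟩ := h2
    exact ⟨_, h1.mul h2⟩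
  exact hD.exists_clm_mul (EuclideanSpace.proj (𝕜 := ℝ) (Sum.inr ℓ : Node t × Fin F ⊕ Leaf t))

/-- The reflection that changes the sign of the leaf responses. -/
def negLeaf (t : BinaryTree Unit) (F : ℕ) : EuclideanSpace ℝ (Node t × Fin F ⊕ Leaf t) ≃ₗᵢ[ℝ]
    EuclideanSpace ℝ (Node t × Fin F ⊕ Leaf t) :=
  LinearIsometryEquiv.piLpCongrRight 2 fun k =>
    Sum.elim (fun _ => LinearIsometryEquiv.refl ℝ ℝ) (fun _ => LinearIsometryEquiv.neg ℝ) k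

/-- A tree is linear in its leaf responses. This oddness makes its Gaussian mean vanish. -/
theorem singleTree_negLeaf (σ : ℝ → ℝ) (x : EuclideanSpace ℝ (Fin F))
    (p : EuclideanSpace ℝ (Node t × Fin F ⊕ Leaf t)) :
    singleTree σ x (negLeaf t F p) = -singleTree σ x p := by
  have h1 : ∀ a, negLeaf t F p (Sum.inl a) = p (Sum.inl a) := fun _ => rfl
  have h2 : ∀ ℓ, negLeaf t F p (Sum.inr ℓ) = -p (Sum.inr ℓ) := fun _ => rfl
  simp only [singleTree, h1, h2, neg_mul, Finset.sum_neg_distrib]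

theorem ntk_eq_averageKernel {σ : ℝ → ℝ} {x x' : EuclideanSpace ℝ (Fin F)} {C C' : ℝ}
    (hx : LinearGrowthC11 C (singleTree (t := t) σ x))
    (hx' : LinearGrowthC11 C' (singleTree (t := t) σ x')) (θ : Params t F M) :
    ntk σ θ x x' = averageKernel (singleTree σ x) (singleTree σ x') θ := by
  rw [ntk, ensemble_eq_average, ensemble_eq_average,
    (hasGradientAt_average hx.differentiable θ).gradient,
    (hasGradientAt_average hx'.differentiable θ).gradient, inner_averageGrad]

theorem gradient_loss {σ : ℝ → ℝ} {x : Fin N → EuclideanSpace ℝ (Fin F)} {C : ℝ}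
    (hx : ∀ i, LinearGrowthC11 C (singleTree (t := t) σ (x i))) (y : Fin N → ℝ)
    (θ : Params t F M) :
    gradient (loss σ x y) θ = averageLossGrad (fun i => singleTree σ (x i)) y θ :=
  (hasGradientAt_averageLoss hx y θ).gradient

end Tree

/-! ### Good initializations and concentration along the flow. -/

section Initialization

variable {J : Type*} [Fintype J] {N : ℕ} {C : ℝ} {g : Fin N → EuclideanSpace ℝ J → ℝ}

/-- With high probability over the Gaussian initialization, the kernel of a large ensemble is close
to its limit, the fourth moments of the members are bounded on average, and the predictions are
bounded. -/
theorem exists_good_initialization (hg : ∀ i, LinearGrowthC11 C (g i))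
    (h0 : ∀ i, ∫ p, g i p ∂stdGaussian (EuclideanSpace ℝ J) = 0) {ε δ : ℝ} (hε : 0 < ε)
    (hδ : 0 < δ) :
    ∃ (K U : ℝ) (M₀ : ℕ), 0 < M₀ ∧ ∀ M : ℕ, M₀ ≤ M →
      stdGaussian (EuclideanSpace ℝ (Fin M × J)) {θ |
        ¬ ((∀ i j, |averageKernel (g i) (g j) θ - limitKernel g i j| ≤ ε) ∧
          (1 / (M : ℝ)) * ∑ m, (1 + ‖blocks J M θ m‖) ^ 4 ≤ K ∧
          ∀ i, |average (g i) θ| ≤ U)} ≤ ENNReal.ofReal δ := by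
  have hgL : ∀ i, MemLp (g i) 2 (stdGaussian (EuclideanSpace ℝ J)) := fun i =>
    memLp_two_of_abs_le (hg i).differentiable.continuous (hg i).abs_le
  set φ : EuclideanSpace ℝ J → ℝ := fun p => (1 + ‖p‖) ^ 4 with hφ
  set K := ∫ p, φ p ∂stdGaussian (EuclideanSpace ℝ J) with hK
  set V := ∑ i, variance (g i) (stdGaussian (EuclideanSpace ℝ J)) with hV
  have hV0 : 0 ≤ V := Finset.sum_nonneg fun i _ => variance_nonneg _ _
  -- Chosen so that `V / U ^ 2 ≤ δ / 2`; the `+ 1` keeps `U` positive when `V = 0`.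
  set U := √((V + 1) / (δ / 2)) with hU
  have hU0 : 0 < U := Real.sqrt_pos.2 (by positivity)
  have hlim : Tendsto (fun M : ℕ =>
      (∑ i, ∑ j, stdGaussian (EuclideanSpace ℝ (Fin M × J))
        {θ | ε ≤ |averageKernel (g i) (g j) θ - limitKernel g i j|}) +
      stdGaussian (EuclideanSpace ℝ (Fin M × J))
        {θ | 1 ≤ |(1 / (M : ℝ)) * ∑ m, φ (blocks J M θ m) - K|}) atTop (𝓝 0) := by
    have h1 : ∀ i j, Tendsto (fun M : ℕ => stdGaussian (EuclideanSpace ℝ (Fin M × J))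
        {θ | ε ≤ |averageKernel (g i) (g j) θ - limitKernel g i j|}) atTop (𝓝 0) := fun i j =>
      tendsto_stdGaussian_abs_mean_sub_ge
        ((hg i).continuous_gradient.inner (hg j).continuous_gradient).measurable
        (memLp_inner_gradient hg i j) hε
    have h2 := tendsto_stdGaussian_abs_mean_sub_ge (φ := φ) (by fun_prop)
      (memLp_norm_stdGaussian 4) one_pos
    have h3 := (tendsto_finsetSum Finset.univ fun i _ =>
      tendsto_finsetSum Finset.univ fun j _ => h1 i j).add h2
    simpa using h3
  have hev := hlim.eventually (ge_mem_nhds (ENNReal.ofReal_pos.2 (half_pos hδ)))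
  obtain ⟨M₁, hM₁⟩ := eventually_atTop.1 hev
  refine ⟨K + 1, U, max M₁ 1, by positivity, fun M hM => ?_⟩
  have hM0 : 0 < M := (le_max_right _ _).trans hM
  have hsmall := hM₁ M ((le_max_left _ _).trans hM)
  set P := stdGaussian (EuclideanSpace ℝ (Fin M × J))
  have hsub : {θ : EuclideanSpace ℝ (Fin M × J) |
        ¬ ((∀ i j, |averageKernel (g i) (g j) θ - limitKernel g i j| ≤ ε) ∧
          (1 / (M : ℝ)) * ∑ m, (1 + ‖blocks J M θ m‖) ^ 4 ≤ K + 1 ∧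
          ∀ i, |average (g i) θ| ≤ U)} ⊆
      ((⋃ i, ⋃ j, {θ | ε ≤ |averageKernel (g i) (g j) θ - limitKernel g i j|}) ∪
        {θ | 1 ≤ |(1 / (M : ℝ)) * ∑ m, φ (blocks J M θ m) - K|}) ∪
      ⋃ i, {θ | U ≤ |average (g i) θ|} := by
    intro θ hθ
    by_contra hc
    simp only [Set.mem_union, Set.mem_iUnion, Set.mem_ofPred_eq, not_or, not_exists, not_le] at hc
    refine hθ ⟨fun i j => (hc.1.1 i j).le, ?_, fun i => (hc.2 i).le⟩
    have := (abs_lt.1 hc.1.2).2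
    linarith
  have hpred : ∑ i, P {θ | U ≤ |average (g i) θ|} ≤ ENNReal.ofReal (δ / 2) := by
    calc ∑ i, P {θ | U ≤ |average (g i) θ|}
        ≤ ∑ i, ENNReal.ofReal (variance (g i) (stdGaussian (EuclideanSpace ℝ J)) / U ^ 2) :=
          Finset.sum_le_sum fun i _ => stdGaussian_abs_average_ge_le
            (hg i).differentiable.continuous.measurable (hgL i) (h0 i) hM0 hU0
      _ = ENNReal.ofReal (V / U ^ 2) := by
          rw [← ENNReal.ofReal_sum_of_nonneg fun i _ => div_nonneg (variance_nonneg _ _)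
            (sq_nonneg _), hV, Finset.sum_div]
      _ ≤ ENNReal.ofReal (δ / 2) := by
          refine ENNReal.ofReal_le_ofReal ?_
          rw [hU, Real.sq_sqrt (by positivity), div_div_eq_mul_div, div_le_iff₀ (by positivity)]
          nlinarith
  calc _ ≤ _ := measure_mono hsub
    _ ≤ ((∑ i, ∑ j, P {θ | ε ≤ |averageKernel (g i) (g j) θ - limitKernel g i j|}) +
        P {θ | 1 ≤ |(1 / (M : ℝ)) * ∑ m, φ (blocks J M θ m) - K|}) +
        ∑ i, P {θ | U ≤ |average (g i) θ|} := by
      refine (measure_union_le _ _).trans (add_le_add ((measure_union_le _ _).trans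
        (add_le_add ?_ le_rfl)) (measure_iUnion_fintype_le _ _))
      exact (measure_iUnion_fintype_le _ _).trans
        (Finset.sum_le_sum fun i _ => measure_iUnion_fintype_le _ _)
    _ ≤ ENNReal.ofReal (δ / 2) + ENNReal.ofReal (δ / 2) := add_le_add hsmall hpred
    _ = ENNReal.ofReal δ := by
      rw [← ENNReal.ofReal_add (half_pos hδ).le (half_pos hδ).le, add_halves]

/-- Concentration of the kernel of a large ensemble along the gradient flow. -/
theorem averageKernel_gradientFlow (hg : ∀ i, LinearGrowthC11 C (g i))
    (h0 : ∀ i, ∫ p, g i p ∂stdGaussian (EuclideanSpace ℝ J) = 0) (y : Fin N → ℝ) {η δ : ℝ}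
    (hη : 0 < η) (hδ : 0 < δ) :
    ∃ (D : ℝ) (M₀ : ℕ), ∀ M : ℕ, M₀ ≤ M →
      stdGaussian (EuclideanSpace ℝ (Fin M × J)) {θ₀ | ¬ (
        (∃ γ : ℝ → EuclideanSpace ℝ (Fin M × J), γ 0 = θ₀ ∧ ∀ τ, 0 ≤ τ →
          HasDerivWithinAt γ (-η • averageLossGrad g y (γ τ)) (Set.Ici 0) τ) ∧
        ∀ γ : ℝ → EuclideanSpace ℝ (Fin M × J), γ 0 = θ₀ → (∀ τ, 0 ≤ τ →
          HasDerivWithinAt γ (-η • averageLossGrad g y (γ τ)) (Set.Ici 0) τ) →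
          ∀ τ, 0 ≤ τ → ∀ i j, |averageKernel (g i) (g j) (γ τ) - averageKernel (g i) (g j) θ₀| ≤
            D / √M)} ≤ ENNReal.ofReal δ := by
  obtain ⟨lam, hlam, hcoer⟩ := exists_pos_limitKernel_coercive hg
  set B := ∑ i, ∑ j, |limitKernel g i j| with hB
  have hBij : ∀ i j, |limitKernel g i j| ≤ B := fun i j =>
    (Finset.single_le_sum (f := fun j => |limitKernel g i j|) (fun _ _ => abs_nonneg _)
      (Finset.mem_univ j)).trans
    (Finset.single_le_sum (f := fun i => ∑ j, |limitKernel g i j|)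
      (fun _ _ => Finset.sum_nonneg fun _ _ => abs_nonneg _) (Finset.mem_univ i))
  have hB0 : 0 ≤ B := Finset.sum_nonneg fun _ _ => Finset.sum_nonneg fun _ _ => abs_nonneg _
  -- The first bound leaves half of the coercivity, with `N + 1` keeping the denominator positive;
  -- the second keeps the kernel entries below `B + 1`.
  set ε := min (lam / (4 * (N + 1))) (1 / 2) with hεdef
  have hε : 0 < ε := lt_min (by positivity) (by norm_num)
  have hε1 : 2 * ε ≤ 1 := by
    have := min_le_right (lam / (4 * (N + 1))) (1 / 2 : ℝ)
    linarith
  have hεN : N * (2 * ε) ≤ lam / 2 := by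
    have h1 : ε ≤ lam / (4 * (N + 1)) := min_le_left _ _
    rw [le_div_iff₀ (by positivity)] at h1
    nlinarith
  obtain ⟨K, U, M₁, hM₁, hgood⟩ := exists_good_initialization hg h0 hε hδ
  set Y := U + ∑ i, |y i| with hY
  -- The path-length bound for the largest initial residual, plus `1` for strictness. It does not
  -- depend on `M`, so `M₂` can be chosen afterwards with `D / √M ≤ ε`.
  set R := √(2 * (N * (B + 1))) * √(N * Y ^ 2) / (lam / 2) + 1 with hR
  set D := C ^ 2 * (8 * √K * R + 2 * R ^ 3) with hD
  have hlimD : Tendsto (fun M : ℕ => D / √(M : ℝ)) atTop (𝓝 0) :=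
    (Real.tendsto_sqrt_atTop.comp tendsto_natCast_atTop_atTop).const_div_atTop D
  obtain ⟨M₂, hM₂⟩ := eventually_atTop.1 (hlimD.eventually (ge_mem_nhds hε))
  refine ⟨D, max M₁ M₂, fun M hM => (measure_mono ?_).trans (hgood M ((le_max_left _ _).trans hM))⟩
  have hM0 : 0 < M := hM₁.trans_le ((le_max_left _ _).trans hM)
  -- The bad event is contained in the complement of the good initializations, so monotonicity of
  -- the outer measure suffices and no measurability is needed.
  refine fun θ₀ => mt fun ⟨hk, h4, hav⟩ => ?_
  have hball : ∀ θ ∈ Metric.closedBall θ₀ R, ∀ i j,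
      |averageKernel (g i) (g j) θ - averageKernel (g i) (g j) θ₀| ≤ D / √M := fun θ hθ i j =>
    abs_averageKernel_sub_le hM0 (hg i) (hg j) h4 hθ
  have hres : ∀ i, |average (g i) θ₀ - y i| ≤ Y := fun i => by
    have h1 := abs_sub (average (g i) θ₀) (y i)
    have h2 := Finset.single_le_sum (f := fun i => |y i|) (fun _ _ => abs_nonneg _)
      (Finset.mem_univ i)
    have h3 := hav i
    linarith
  obtain ⟨hex, hstay⟩ := averageLoss_gradientFlow hg y hlam hη hcoer hB0 hBij hε.le hεN hε1
    (lt_add_one _) hres hk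
    fun θ hθ i j => (hball θ hθ i j).trans (hM₂ M ((le_max_right _ _).trans hM))
  exact ⟨hex, fun γ hγ0 hγ τ hτ i j => hball _ (hstay γ hγ0 hγ τ hτ) i j⟩

end Initialization

end SoftTree

end

/-! ### The main theorem. -/

/-- Let `x₁, …, x_N` be pairwise distinct unit vectors with targets `y`. The kernel at
initialization has a limit `H` in probability as the number of trees `M` tends to infinity, and for
`0 < η < 2 / (lmin + lmax)`, with `lmin`, `lmax` the extreme eigenvalues of `H`, with probability at
least `1 - δ` over the initialization (the exceptional set has outer measure at most `δ`) the
gradient flow exists for all times and the kernel stays within `C / √M` of its initial value, where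
`C` depends on `δ` but not on `M`. -/
theorem theorem4 (t : BinaryTree Unit) (F N : ℕ) (hN : 0 < N)
    (s : ℝ → ℝ) (hs : SoftTree.IsSigmoidLike s) (α : ℝ) (hα : 0 < α)
    (x : Fin N → EuclideanSpace ℝ (Fin F)) (y : Fin N → ℝ)
    (hx : ∀ i, ‖x i‖ = 1) (hxne : ∀ i j, i ≠ j → x i ≠ x j) :
    ∃ H : Matrix (Fin N) (Fin N) ℝ,
      SoftTree.IsLimitingNTK t (SoftTree.decision s α) x H ∧
      ∀ lmin lmax : ℝ,
        IsLeast {l : ℝ | Module.End.HasEigenvalue (Matrix.toLin' H) l} lmin →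
        IsGreatest {l : ℝ | Module.End.HasEigenvalue (Matrix.toLin' H) l} lmax →
        ∀ η : ℝ, 0 < η → η < 2 / (lmin + lmax) →
          ∀ δ : ℝ, 0 < δ → ∃ (C : ℝ) (M₀ : ℕ), ∀ M : ℕ, M₀ ≤ M →
            SoftTree.initLaw t F M
              {θ₀ | ¬ ((∃ θ : ℝ → SoftTree.Params t F M,
                    SoftTree.IsGradientFlow (SoftTree.decision s α) x y η θ₀ θ) ∧
                  ∀ θ : ℝ → SoftTree.Params t F M,
                    SoftTree.IsGradientFlow (SoftTree.decision s α) x y η θ₀ θ →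
                    ∀ τ : ℝ, 0 ≤ τ → ∀ i j : Fin N,
                      |SoftTree.ntk (SoftTree.decision s α) (θ τ) (x i) (x j) -
                        SoftTree.ntk (SoftTree.decision s α) (θ 0) (x i) (x j)| ≤
                          C / Real.sqrt M)} ≤ ENNReal.ofReal δ := by
  have hσ := hs.exists_boundedC11_decision α
  set σ := SoftTree.decision s α
  choose C₀ hC₀ using fun i => SoftTree.exists_linearGrowthC11_singleTree (t := t) hσ (x i)
  -- Summing the nonnegative constants gives one constant valid for all inputs.
  have hg : ∀ i, SoftTree.LinearGrowthC11 (∑ i, C₀ i) (SoftTree.singleTree (t := t) σ (x i)) :=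
    fun i => (hC₀ i).mono
      (Finset.single_le_sum (fun i _ => (hC₀ i).nonneg) (Finset.mem_univ i))
  have h0 : ∀ i, ∫ p, SoftTree.singleTree (t := t) σ (x i) p ∂stdGaussian
      (EuclideanSpace ℝ (SoftTree.Node t × Fin F ⊕ SoftTree.Leaf t)) = 0 := fun i =>
    SoftTree.integral_stdGaussian_eq_zero (SoftTree.negLeaf t F)
      (SoftTree.singleTree_negLeaf σ (x i))
  refine ⟨Matrix.of (SoftTree.limitKernel fun i => SoftTree.singleTree (t := t) σ (x i)),
    fun i j ε hε => ?_, fun _ _ _ _ η hη _ δ hδ => ?_⟩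
  · simp only [SoftTree.ntk_eq_averageKernel (hg i) (hg j)]
    exact SoftTree.tendsto_stdGaussian_abs_mean_sub_ge
      ((hg i).continuous_gradient.inner (hg j).continuous_gradient).measurable
      (SoftTree.memLp_inner_gradient hg i j) hε
  · obtain ⟨D, M₀, hM₀⟩ := SoftTree.averageKernel_gradientFlow hg h0 y hη hδ
    refine ⟨D, M₀, fun M hM => (measure_mono ?_).trans (hM₀ M hM)⟩
    refine fun θ₀ => mt fun ⟨⟨γ, hγ0, hγ⟩, hall⟩ => ⟨⟨γ, hγ0, fun τ hτ => ?_⟩,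
      fun γ hγ τ hτ i j => ?_⟩
    · rw [SoftTree.gradient_loss hg]
      exact hγ τ hτ
    · rw [SoftTree.ntk_eq_averageKernel (hg i) (hg j), SoftTree.ntk_eq_averageKernel (hg i) (hg j),
        hγ.1]
      refine hall γ hγ.1 (fun τ hτ => ?_) τ hτ i j
      rw [← SoftTree.gradient_loss hg]
      exact hγ.2 τ hτ
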